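/- Setting. Let $d,N\ge 1$, $p\ge 0$. Let $(X_{t_j})_{0\le j\le N}$ be a process with values in $\mathbb{R}^d$, and $Z_{t_j}=h_j(X_{t_j})$ with $h_j$ measurable and $\mathbb{E}[Z_{t_j}^2]<\infty$. For $1\le j\le N-1$, $X_{t_j}$ takes values in $[0,1]^d$ and has a density with respect to the Lebesgue measure. Let $(X^{(m)})_{m\ge1}$ be independent copies of the path $X$, with payoffs $Z^{(m)}_{t_j}=h_j(X^{(m)}_{t_j})$. Regression trees. A splitting strategy of depth $p$ assigns to each inner node of the complete binary tree of depth $p$ a direction $i\in\{1,\dots,d\}$ and one of the two rules "midpoint" and "optimised". Given a distribution $\nu$ of pairs $(x,y)\in[0,1]^d\times\mathbb{R}$ and a splitting strategy, a regression tree of depth $p$ is grown as follows, from the cell $[0,1]^d$ on. A cell is split along the direction $i$ of its node into the parts $\{x(i)\le a\}$ and $\{x(i)>a\}$, where the threshold $a$ is the midpoint of the side $i$ of the cell (midpoint rule) or minimises, jointly with $y_L,y_R\in\mathbb{R}$ and among all thresholds in that side, the squared error of $y_L\mathbb{1}_{\{x(i)\le a\}}+y_R\mathbb{1}_{\{x(i)>a\}}$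 on the cell under $\nu$ (optimised rule). The same is done in both parts until there are $2^p$ leaves. The value of the tree on a leaf is the mean of $y$ there under $\nu$ (any number if the leaf has mass zero). Theoretical and Monte Carlo policies. Fix a splitting strategy for each date $t_1,\dots,t_{N-1}$; it is the same for the theoretical and for the Monte Carlo trees. Define backwards $\tau^p_N=t_N$ and, for $1\le j\le N-1$, let $\mathcal{T}^j_p$ be the regression tree for the joint law of $(X_{t_j},Z_{\tau^p_{j+1}})$, and $$\tau^p_j=t_j\mathbb{1}_{\{Z_{t_j}\ge \mathcal{T}^j_p(X_{t_j})\}}+\tau^p_{j+1}\mathbb{1}_{\{Z_{t_j}<\mathcal{T}^j_p(X_{t_j})\}}.$$ For $M\ge1$, define likewise $\hat\tau^{p,(m)}_N=t_N$ and, for $1\le j\le N-1$, let $\hat{\mathcal{T}}^{j,M}_p$ be a regression tree for the empirical measure of the pairs $(X^{(m)}_{t_j},Z^{(m)}_{\hat\tau^{p,(m)}_{j+1}})$, $1\le m\le M$ (ties between minimisers being broken arbitrarily), and $$\hat\tau^{p,(m)}_j=t_j\mathbb{1}_{\{Z^{(m)}_{t_j}\ge \hat{\mathcal{T}}^{j,M}_p(X^{(m)}_{t_j})\}}+\hat\tau^{p,(m)}_{j+1}\mathbb{1}_{\{Z^{(m)}_{t_j}<\hat{\mathcal{T}}^{j,M}_p(X^{(m)}_{t_j})\}}.$$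 It is assumed that the theoretical trees are well defined: for $1\le j\le N-1$, any two regression trees for the joint law of $(X_{t_j},Z_{\tau^p_{j+1}})$ (with the given strategy) take the same value at $X_{t_j}$ almost surely. Theorem. Assume that $\mathbb{P}(Z_{t_j}=\mathcal{T}^j_p(X_{t_j}))=0$ for all $1\le j\le N-1$. Then for $\alpha\in\{1,2\}$ and every $j=1,\dots,N$, $(Z_{\tau^p_j})^\alpha$ is integrable and $$\lim_{M\to\infty}\frac1M\sum_{m=1}^M\bigl(Z^{(m)}_{\hat\tau^{p,(m)}_j}\bigr)^\alpha=\mathbb{E}\bigl[(Z_{\tau^p_j})^\alpha\bigr]\quad\text{a.s.}$$ In particular, the price estimator is strongly consistent at fixed depth: almost surely, as $M\to\infty$, $$\max\Bigl(Z_{t_0},\frac1M\sum_{m=1}^M Z^{(m)}_{\hat\tau^{p,(m)}_1}\Bigr)\to\max\bigl(Z_{t_0},\mathbb{E}[Z_{\tau^p_1}]\bigr).$$ -/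

import Mathlib

open MeasureTheory ProbabilityTheory Filter Topology

/-- A splitting strategy of depth `n` in dimension `d`: every node of the complete binary tree of
depth `n` carries the direction of its split and a flag saying whether the threshold is the
midpoint of the cell (`true`) or is optimised (`false`). -/
inductive SplitStrategy (d : ℕ) : ℕ → Type
  | nil : SplitStrategy d 0
  | node {n : ℕ} (i : Fin d) (mid : Bool) (left right : SplitStrategy d n) : SplitStrategy d (n + 1)

/-- A tree of depth `n` (with `2 ^ n` leaves): every node carries a direction and a threshold,
every leaf carries a value. -/
inductive RegTree (d : ℕ) : ℕ → Type
  | leaf (v : ℝ) : RegTree d 0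
  | node {n : ℕ} (i : Fin d) (a : ℝ) (left right : RegTree d n) : RegTree d (n + 1)

/-- The piecewise constant function of a tree: at a node with direction `i` and threshold `a`,
the point `x` goes to the left if `x i ≤ a` and to the right if `x i > a`. -/
noncomputable def RegTree.eval {d : ℕ} : {n : ℕ} → RegTree d n → (Fin d → ℝ) → ℝ
  | _, .leaf v, _ => v
  | _, .node i a L R, x => if x i ≤ a then L.eval x else R.eval x

/-- The mean squared error, under the distribution `ν` of (regressor, response), of the function
equal to `yL` on `{x | x i ≤ a}` and to `yR` on `{x | x i > a}`. -/
noncomputable def splitLoss {d : ℕ} (ν : Measure ((Fin d → ℝ) × ℝ)) (i : Fin d)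
    (a yL yR : ℝ) : ℝ :=
  ∫ z, (z.2 - if z.1 i ≤ a then yL else yR) ^ 2 ∂ν

/-- `IsRegTree ν l u s t`: `t` is a least-squares regression tree for the (finite) measure `ν` on
pairs (regressor, response), grown in the cell with lower corner `l` and upper corner `u`
according to the strategy `s`. At each node, the threshold is the midpoint of the current cell, or
it minimises, together with the two values, the squared error over all thresholds of the current
cell. The data are then split by the threshold, that is, `ν` is restricted to each half, and
the process goes on in both halves. The value at a leaf is the constant that minimises the squared
error over that leaf, that is, the mean of the response there.

The theoretical tree is obtained when `ν` is the joint law of the regressor and the response, the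
empirical one when `ν` is the empirical measure of the sample. -/
def IsRegTree {d : ℕ} : {n : ℕ} → Measure ((Fin d → ℝ) × ℝ) → (Fin d → ℝ) → (Fin d → ℝ) →
    SplitStrategy d n → RegTree d n → Prop
  | _, ν, _, _, .nil, .leaf v => ∀ c : ℝ, ∫ z, (z.2 - v) ^ 2 ∂ν ≤ ∫ z, (z.2 - c) ^ 2 ∂ν
  | _, ν, l, u, .node i mid sL sR, .node i' a L R =>
      i' = i ∧
      (if mid = true then a = (l i + u i) / 2
        else a ∈ Set.Icc (l i) (u i) ∧
          ∃ yL yR : ℝ, ∀ a' ∈ Set.Icc (l i) (u i), ∀ yL' yR' : ℝ,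
            splitLoss ν i a yL yR ≤ splitLoss ν i a' yL' yR') ∧
      IsRegTree (ν.restrict {z | z.1 i ≤ a}) l (Function.update u i a) sL L ∧
      IsRegTree (ν.restrict {z | a < z.1 i}) (Function.update l i a) u sR R

/-- The empirical measure of the first `M` points of a sequence. -/
noncomputable def empMeasure {E : Type*} [MeasurableSpace E] (M : ℕ) (g : ℕ → E) : Measure E :=
  (M : ENNReal)⁻¹ • ∑ m ∈ Finset.range M, Measure.dirac (g m)

/-- The exercise policy along a path `x`, with payoff functions `h` and (approximate) continuation
values `C`. Exercise dates are identified with their indices: `τ_N = N`, and for `j < N`,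
`τ_j = j` if `h j (x j) ≥ C j (x j)` and `τ_j = τ_{j+1}` otherwise. -/
noncomputable def exerciseIndex {E : Type*} {N : ℕ} (h : Fin (N + 1) → E → ℝ)
    (C : Fin N → E → ℝ) (x : Fin (N + 1) → E) (j : Fin (N + 1)) : Fin (N + 1) :=
  Fin.reverseInduction (motive := fun _ => Fin (N + 1)) (Fin.last N)
    (fun i τ => if C i (x i.castSucc) ≤ h i.castSucc (x i.castSucc) then i.castSucc else τ) j

/-- The payoff `Z_{τ_j}` along the path `x` of the policy defined by the continuation values that
are given by the trees `T`. -/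
noncomputable def policyPayoff {d N p : ℕ} (h : Fin (N + 1) → (Fin d → ℝ) → ℝ)
    (T : Fin N → RegTree d p) (x : Fin (N + 1) → Fin d → ℝ) (j : Fin (N + 1)) : ℝ :=
  h (exerciseIndex h (fun i => (T i).eval) x j) (x (exerciseIndex h (fun i => (T i).eval) x j))

/-- The joint law of the regressor `X_j` and the response `Z_{τ_{j+1}}` of the policy given
by `T`. -/
noncomputable def theoreticalData {Ω : Type*} [MeasurableSpace Ω] (P : Measure Ω) {d N p : ℕ}
    (h : Fin (N + 1) → (Fin d → ℝ) → ℝ) (T : Fin N → RegTree d p)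
    (X : Fin (N + 1) → Ω → Fin d → ℝ) (j : Fin N) : Measure ((Fin d → ℝ) × ℝ) :=
  P.map (fun ω => (X j.castSucc ω, policyPayoff h T (fun k => X k ω) j.succ))

/-- The empirical measure of the pairs `(X_j, Z_{τ_{j+1}})`, for the policy given by `T`, along the
first `M` of the paths `x 0, x 1, …`. -/
noncomputable def empiricalData {d N p : ℕ}
    (h : Fin (N + 1) → (Fin d → ℝ) → ℝ) (T : Fin N → RegTree d p) (M : ℕ)
    (x : ℕ → Fin (N + 1) → Fin d → ℝ) (j : Fin N) : Measure ((Fin d → ℝ) × ℝ) :=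
  empMeasure M (fun m => (x m j.castSucc, policyPayoff h T (x m) j.succ))

/-! ### Moment convergence on cells, and its stability under splits -/

section Cells

variable {d : ℕ}

/-! The estimated policy depends on the whole sample, so the law of large numbers does not apply to
its payoffs directly. Along each sampled path it is compared with the theoretical policy, whose
payoffs are i.i.d. Backwards in the date, the mean over the first `M` paths of the squared
difference of the two payoffs tends to 0 (`tendsto_avg_policyPayoff_sub_sq`); the strong law for the
theoretical policy then gives the moments. Randomness enters only through strong laws for countably
many functions: off one null set everything is deterministic.

The backward step rests on the stability of trees. If the masses and the first two response moments
converge on rational cells (`MomentConv`), and the limit does not charge hyperplanes, they also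
converge for moving thresholds, so the convergence passes to both halves of a split. By compactness
of the thresholds, the trees have a subsequential limit, which is a regression tree for the limit
law (`exists_limit_tree`); by uniqueness it is the theoretical one (`tendsto_tree`).

The two policies then decide differently only where the trees are far apart, which is asymptotically
rare, or where the payoff is close to the continuation value, which is rare by non-degeneracy.
Unbounded payoffs are truncated through the envelope `∑ k, h k (x k) ^ 2`. -/

theorem measurableSet_coord_le (i : Fin d) (a : ℝ) :
    MeasurableSet {z : (Fin d → ℝ) × ℝ | z.1 i ≤ a} :=
  measurableSet_le (by fun_prop) measurable_const

theorem measurableSet_lt_coord (i : Fin d) (a : ℝ) :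
    MeasurableSet {z : (Fin d → ℝ) × ℝ | a < z.1 i} :=
  measurableSet_lt measurable_const (by fun_prop)

theorem compl_coord_le (i : Fin d) (a : ℝ) :
    {z : (Fin d → ℝ) × ℝ | z.1 i ≤ a}ᶜ = {z | a < z.1 i} := by
  ext z; simp

/-- A finite intersection of half-spaces with rational thresholds, in the regressor variable. -/
def ratCell : List (Fin d × ℚ × Bool) → Set ((Fin d → ℝ) × ℝ)
  | [] => Set.univ
  | (i, q, true) :: c => ratCell c ∩ {z | z.1 i ≤ q}
  | (i, q, false) :: c => ratCell c ∩ {z | (q : ℝ) < z.1 i}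

theorem measurableSet_ratCell (c : List (Fin d × ℚ × Bool)) : MeasurableSet (ratCell c) := by
  induction c with
  | nil => exact MeasurableSet.univ
  | cons b c ih =>
    obtain ⟨i, q, _ | _⟩ := b
    · exact ih.inter (measurableSet_lt_coord i q)
    · exact ih.inter (measurableSet_coord_le i q)

theorem mem_ratCell_congr {c : List (Fin d × ℚ × Bool)} {z z' : (Fin d → ℝ) × ℝ}
    (hz : z.1 = z'.1) : z ∈ ratCell c ↔ z' ∈ ratCell c := by
  induction c with
  | nil => simp [ratCell]
  | cons b c ih => obtain ⟨i, q, _ | _⟩ := b <;> simp [ratCell, ih, hz]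

/-- Convergence of the masses and of the first two moments of the response over all rational
cells. -/
structure MomentConv (ν : ℕ → Measure ((Fin d → ℝ) × ℝ)) (μ : Measure ((Fin d → ℝ) × ℝ)) :
    Prop where
  finite : ∀ k, IsFiniteMeasure (ν k)
  finite_lim : IsFiniteMeasure μ
  integrable : ∀ k, Integrable (fun z => z.2 ^ 2) (ν k)
  integrable_lim : Integrable (fun z => z.2 ^ 2) μ
  null : ∀ (i : Fin d) (a : ℝ), μ {z | z.1 i = a} = 0
  conv : ∀ c : List (Fin d × ℚ × Bool), ∀ r ≤ 2,
    Tendsto (fun k => ∫ z in ratCell c, z.2 ^ r ∂(ν k)) atTop (𝓝 (∫ z in ratCell c, z.2 ^ r ∂μ))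

theorem integrable_response_pow {ν : Measure ((Fin d → ℝ) × ℝ)} [IsFiniteMeasure ν]
    (h2 : Integrable (fun z => z.2 ^ 2) ν) {r : ℕ} (hr : r ≤ 2) :
    Integrable (fun z => z.2 ^ r) ν := by
  refine Integrable.mono' (g := fun z => 1 + z.2 ^ 2) ((integrable_const 1).add h2)
    (by fun_prop) (Eventually.of_forall fun z => ?_)
  rw [Real.norm_eq_abs]
  interval_cases r
  · simp; positivity
  · rw [pow_one, abs_le]; constructor <;> nlinarith [sq_nonneg (z.2 - 1), sq_nonneg (z.2 + 1)]
  · rw [abs_of_nonneg (sq_nonneg _)]; linarith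

theorem abs_pow_le_one_add_sq (y : ℝ) {r : ℕ} (hr : r ≤ 2) : |y ^ r| ≤ 1 + y ^ 2 := by
  interval_cases r
  · simp; positivity
  · rw [pow_one, abs_le]; constructor <;> nlinarith [sq_nonneg (y - 1), sq_nonneg (y + 1)]
  · rw [abs_of_nonneg (sq_nonneg _)]; linarith

theorem abs_setIntegral_sub_le {E : Type*} [MeasurableSpace E] {ν : Measure E} {S T : Set E}
    {f : E → ℝ} (hS : MeasurableSet S) (hST : S ⊆ T) (hf : Integrable f ν) :
    |∫ x in T, f x ∂ν - ∫ x in S, f x ∂ν| ≤ ∫ x in T \ S, |f x| ∂ν := by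
  have : ∫ x in T, f x ∂ν - ∫ x in S, f x ∂ν = ∫ x in T \ S, f x ∂ν := by
    rw [setIntegral_sdiff hS hf.integrableOn hST]
  rw [this]
  exact abs_integral_le_integral_abs

/-- A slab around `a` carries little of the integral of `g` when hyperplanes are null. -/
theorem exists_rat_slab_integral_lt {μ : Measure ((Fin d → ℝ) × ℝ)} {g : (Fin d → ℝ) × ℝ → ℝ}
    (hg : Integrable g μ) (hg0 : ∀ z, 0 ≤ g z) {i : Fin d} {a : ℝ} (h0 : μ {z | z.1 i = a} = 0)
    {ε : ℝ} (hε : 0 < ε) :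
    ∃ q r : ℚ, (q : ℝ) < a ∧ a < r ∧ ∫ z in {z | (q : ℝ) < z.1 i} ∩ {z | z.1 i ≤ r}, g z ∂μ < ε := by
  have hmeas : ∀ n : ℕ, MeasurableSet
      {z : (Fin d → ℝ) × ℝ | |z.1 i - a| ≤ 1 / ((n : ℝ) + 1)} := fun n =>
    measurableSet_le (by fun_prop) measurable_const
  have hanti : Antitone fun n : ℕ =>
      {z : (Fin d → ℝ) × ℝ | |z.1 i - a| ≤ 1 / ((n : ℝ) + 1)} := fun m n hmn z hz =>
    show |z.1 i - a| ≤ _ from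
      le_trans (show |z.1 i - a| ≤ _ from hz) (Nat.one_div_le_one_div hmn)
  -- The closed slabs decrease to the null hyperplane, so the integrals over them tend to 0.
  have hlim := tendsto_setIntegral_of_antitone hmeas hanti ⟨0, hg.integrableOn⟩
  have hzero : ∫ z in ⋂ n : ℕ, {z : (Fin d → ℝ) × ℝ | |z.1 i - a| ≤ 1 / ((n : ℝ) + 1)}, g z ∂μ
      = 0 := by
    refine setIntegral_measure_zero _ (measure_mono_null (fun z hz => ?_) h0)
    have hz' : ∀ n : ℕ, |z.1 i - a| ≤ 1 / ((n : ℝ) + 1) := fun n => Set.mem_iInter.1 hz n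
    have := ge_of_tendsto' (tendsto_one_div_add_atTop_nhds_zero_nat (𝕜 := ℝ)) hz'
    have h3 := abs_nonpos_iff.1 this
    show z.1 i = a
    linarith
  rw [hzero] at hlim
  obtain ⟨n, hn⟩ := (hlim.eventually (gt_mem_nhds hε)).exists
  have hpos : 0 < 1 / ((n : ℝ) + 1) := Nat.one_div_pos_of_nat
  obtain ⟨q, hq1, hq2⟩ := exists_rat_btwn (show a - 1 / ((n : ℝ) + 1) < a by linarith)
  obtain ⟨r, hr1, hr2⟩ := exists_rat_btwn (show a < a + 1 / ((n : ℝ) + 1) by linarith)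
  refine ⟨q, r, hq2, hr1, lt_of_le_of_lt ?_ hn⟩
  refine setIntegral_mono_set hg.integrableOn (Eventually.of_forall fun z => hg0 z)
    (Eventually.of_forall fun z hz => ?_)
  have h1 : (q : ℝ) < z.1 i := hz.1
  have h2 : z.1 i ≤ r := hz.2
  show |z.1 i - a| ≤ _
  rw [abs_le]
  constructor <;> linarith

namespace MomentConv

variable {ν : ℕ → Measure ((Fin d → ℝ) × ℝ)} {μ : Measure ((Fin d → ℝ) × ℝ)}

theorem comp (h : MomentConv ν μ) {φ : ℕ → ℕ} (hφ : Tendsto φ atTop atTop) :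
    MomentConv (fun k => ν (φ k)) μ :=
  ⟨fun _ => h.finite _, h.finite_lim, fun _ => h.integrable _, h.integrable_lim, h.null,
    fun c r hr => (h.conv c r hr).comp hφ⟩

theorem conv_univ (h : MomentConv ν μ) {r : ℕ} (hr : r ≤ 2) :
    Tendsto (fun k => ∫ z, z.2 ^ r ∂(ν k)) atTop (𝓝 (∫ z, z.2 ^ r ∂μ)) := by
  simpa [ratCell] using h.conv [] r hr

theorem conv_mass (h : MomentConv ν μ) (c : List (Fin d × ℚ × Bool)) :
    Tendsto (fun k => (ν k).real (ratCell c)) atTop (𝓝 (μ.real (ratCell c))) := by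
  simpa using h.conv c 0 (by norm_num)

/-- The moving threshold is replaced by a fixed rational one just below `b`. The cost is an integral
over a thin rational slab: small for `μ`, hence for `ν k` with `k` large, because the slab is itself
a rational cell. -/
theorem setIntegral_le_tendsto (h : MomentConv ν μ) (i : Fin d) {a : ℕ → ℝ} {b : ℝ}
    (ha : Tendsto a atTop (𝓝 b)) (c : List (Fin d × ℚ × Bool)) {r : ℕ} (hr : r ≤ 2) :
    Tendsto (fun k => ∫ z in ratCell c ∩ {z | z.1 i ≤ a k}, z.2 ^ r ∂(ν k)) atTop
      (𝓝 (∫ z in ratCell c ∩ {z | z.1 i ≤ b}, z.2 ^ r ∂μ)) := by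
  have := h.finite
  have := h.finite_lim
  rw [Metric.tendsto_atTop']
  intro ε hε
  have hg : Integrable (fun z : (Fin d → ℝ) × ℝ => 1 + z.2 ^ 2) μ :=
    (integrable_const 1).add h.integrable_lim
  obtain ⟨q, s, hq, hs, hqs⟩ := exists_rat_slab_integral_lt hg (fun z => by positivity)
    (h.null i b) (show 0 < ε / 4 by linarith)
  set c' : List (Fin d × ℚ × Bool) := (i, s, true) :: (i, q, false) :: c with hc'
  set B : Measure ((Fin d → ℝ) × ℝ) → ℝ := fun m => ∫ z in ratCell c', (1 + z.2 ^ 2) ∂m with hB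
  have hBeq : ∀ m : Measure ((Fin d → ℝ) × ℝ), IsFiniteMeasure m →
      Integrable (fun z => z.2 ^ 2) m →
      B m = (∫ z in ratCell c', z.2 ^ 0 ∂m) + ∫ z in ratCell c', z.2 ^ 2 ∂m := fun m _ hm => by
    simp only [hB, pow_zero]
    exact integral_add (integrable_const _) hm.integrableOn
  have hBlim : Tendsto (fun k => B (ν k)) atTop (𝓝 (B μ)) := by
    rw [hBeq μ h.finite_lim h.integrable_lim]
    simp_rw [fun k => hBeq (ν k) (h.finite k) (h.integrable k)]
    exact (h.conv c' 0 (by norm_num)).add (h.conv c' 2 le_rfl)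
  have hBμ : B μ < ε / 4 := by
    refine lt_of_le_of_lt ?_ hqs
    refine setIntegral_mono_set hg.integrableOn
      (Eventually.of_forall fun z => by positivity) (Eventually.of_forall fun z hz => ?_)
    exact ⟨hz.1.2, hz.2⟩
  -- One bound for all measures and all thresholds in `(q, s)`; it serves for `ν k` at `a k` and for
  -- `μ` at `b`.
  have key : ∀ (m : Measure ((Fin d → ℝ) × ℝ)), IsFiniteMeasure m →
      Integrable (fun z => z.2 ^ 2) m → ∀ t : ℝ, (q : ℝ) < t → t < s →
      |∫ z in ratCell c ∩ {z | z.1 i ≤ t}, z.2 ^ r ∂m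
        - ∫ z in ratCell ((i, q, true) :: c), z.2 ^ r ∂m| ≤ B m := by
    intro m _ hm t hqt hts
    have hsub : ratCell ((i, q, true) :: c) ⊆ ratCell c ∩ {z | z.1 i ≤ t} := fun z hz =>
      ⟨hz.1, le_trans hz.2 hqt.le⟩
    refine (abs_setIntegral_sub_le (measurableSet_ratCell _) hsub
      (integrable_response_pow hm hr)).trans ?_
    have hgm : Integrable (fun z : (Fin d → ℝ) × ℝ => 1 + z.2 ^ 2) m :=
      (integrable_const 1).add hm
    calc _ ≤ ∫ z in (ratCell c ∩ {z | z.1 i ≤ t}) \ ratCell ((i, q, true) :: c),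
          (1 + z.2 ^ 2) ∂m :=
        integral_mono (integrable_response_pow hm hr).abs.integrableOn hgm.integrableOn
          fun z => abs_pow_le_one_add_sq z.2 hr
      _ ≤ _ := by
        refine setIntegral_mono_set hgm.integrableOn
          (Eventually.of_forall fun z => by positivity) (Eventually.of_forall fun z hz => ?_)
        have h1 : z.1 i ≤ t := hz.1.2
        refine ⟨⟨hz.1.1, ?_⟩, h1.trans hts.le⟩
        by_contra hcon
        exact hz.2 ⟨hz.1.1, show z.1 i ≤ q from not_lt.1 hcon⟩
  have hA := h.conv ((i, q, true) :: c) r hr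
  have e1 := ha.eventually (lt_mem_nhds hq)
  have e2 := ha.eventually (gt_mem_nhds hs)
  have e3 := hBlim.eventually (gt_mem_nhds hBμ)
  have e4 := hA.eventually (Metric.ball_mem_nhds _ (show 0 < ε / 4 by linarith))
  have hall := ((e1.and e2).and (e3.and e4))
  obtain ⟨K, hK⟩ := eventually_atTop.1 hall
  refine ⟨K, fun k hk => ?_⟩
  obtain ⟨⟨h1, h2⟩, h3, h4⟩ := hK k hk.le
  have k1 := key (ν k) (h.finite k) (h.integrable k) (a k) h1 h2
  have k2 := key μ h.finite_lim h.integrable_lim b hq hs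
  rw [Real.dist_eq] at h4 ⊢
  rw [abs_le] at k1 k2
  rw [abs_lt] at h4 ⊢
  constructor <;> linarith [k1.1, k1.2, k2.1, k2.2, h4.1, h4.2]

theorem restrict_le (h : MomentConv ν μ) (i : Fin d) {a : ℕ → ℝ} {b : ℝ}
    (ha : Tendsto a atTop (𝓝 b)) :
    MomentConv (fun k => (ν k).restrict {z | z.1 i ≤ a k}) (μ.restrict {z | z.1 i ≤ b}) := by
  have := h.finite
  have := h.finite_lim
  refine ⟨fun _ => inferInstance, inferInstance, fun k => (h.integrable k).restrict,
    h.integrable_lim.restrict, fun j t => ?_, fun c r hr => ?_⟩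
  · exact le_antisymm ((Measure.restrict_apply_le _ _).trans (h.null j t).le) zero_le
  · simp_rw [Measure.restrict_restrict (measurableSet_ratCell c)]
    exact h.setIntegral_le_tendsto i ha c hr

theorem restrict_lt (h : MomentConv ν μ) (i : Fin d) {a : ℕ → ℝ} {b : ℝ}
    (ha : Tendsto a atTop (𝓝 b)) :
    MomentConv (fun k => (ν k).restrict {z | a k < z.1 i}) (μ.restrict {z | b < z.1 i}) := by
  have := h.finite
  have := h.finite_lim
  refine ⟨fun _ => inferInstance, inferInstance, fun k => (h.integrable k).restrict,
    h.integrable_lim.restrict, fun j t => ?_, fun c r hr => ?_⟩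
  · exact le_antisymm ((Measure.restrict_apply_le _ _).trans (h.null j t).le) zero_le
  · simp_rw [Measure.restrict_restrict (measurableSet_ratCell c)]
    -- The right half is the complement of the left half, so its moments are differences of known
    -- ones.
    have key : ∀ (m : Measure ((Fin d → ℝ) × ℝ)), IsFiniteMeasure m →
        Integrable (fun z => z.2 ^ 2) m → ∀ t : ℝ,
        ∫ z in ratCell c ∩ {z | t < z.1 i}, z.2 ^ r ∂m = ∫ z in ratCell c, z.2 ^ r ∂m
          - ∫ z in ratCell c ∩ {z | z.1 i ≤ t}, z.2 ^ r ∂m := by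
      intro m _ hm t
      have := setIntegral_sdiff
        ((measurableSet_ratCell c).inter (measurableSet_coord_le i t))
        (integrable_response_pow hm hr).integrableOn (Set.inter_subset_left)
      rw [← this, Set.sdiff_self_inter, ← compl_coord_le, Set.sdiff_eq]
    rw [key μ h.finite_lim h.integrable_lim]
    simp_rw [fun k => key (ν k) (h.finite k) (h.integrable k)]
    exact (h.conv c r hr).sub (h.setIntegral_le_tendsto i ha c hr)

end MomentConv

end Cells

/-! ### Squared losses and limits of regression trees -/

section Loss

variable {d : ℕ}

/-- The loss is a quadratic polynomial in `c` whose coefficients are the three moments controlled by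
`MomentConv`; the powers 0 and 1 are kept to match its `conv` field. -/
theorem integral_sq_sub_const {ν : Measure ((Fin d → ℝ) × ℝ)} [IsFiniteMeasure ν]
    (h2 : Integrable (fun z => z.2 ^ 2) ν) (c : ℝ) :
    ∫ z, (z.2 - c) ^ 2 ∂ν
      = ∫ z, z.2 ^ 2 ∂ν - 2 * c * ∫ z, z.2 ^ 1 ∂ν + c ^ 2 * ∫ z, z.2 ^ 0 ∂ν := by
  have h0 := integrable_response_pow h2 (r := 0) (by norm_num)
  have h1 := integrable_response_pow h2 (r := 1) (by norm_num)
  have hadd := integral_add (h2.sub (h1.const_mul (2 * c))) (h0.const_mul (c ^ 2))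
  simp only [Pi.sub_apply] at hadd
  rw [← integral_const_mul, ← integral_const_mul, ← integral_sub h2 (h1.const_mul _), ← hadd]
  congr 1
  ext z
  ring

theorem integrable_sq_sub_const {ν : Measure ((Fin d → ℝ) × ℝ)} [IsFiniteMeasure ν]
    (h2 : Integrable (fun z => z.2 ^ 2) ν) (c : ℝ) :
    Integrable (fun z => (z.2 - c) ^ 2) ν := by
  have h1 := integrable_response_pow h2 (r := 1) (by norm_num)
  refine ((h2.sub (h1.const_mul (2 * c))).add (integrable_const (c ^ 2))).congr
    (Eventually.of_forall fun z => ?_)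
  simp
  ring

/-- The two values decouple: once the threshold is fixed, each half is a separate leaf problem. -/
theorem splitLoss_eq {ν : Measure ((Fin d → ℝ) × ℝ)} [IsFiniteMeasure ν]
    (h2 : Integrable (fun z => z.2 ^ 2) ν) (i : Fin d) (a yL yR : ℝ) :
    splitLoss ν i a yL yR = ∫ z, (z.2 - yL) ^ 2 ∂(ν.restrict {z | z.1 i ≤ a})
      + ∫ z, (z.2 - yR) ^ 2 ∂(ν.restrict {z | a < z.1 i}) := by
  have hm := measurableSet_coord_le i a
  have hint : Integrable (fun z => (z.2 - if z.1 i ≤ a then yL else yR) ^ 2) ν := by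
    have := ((integrable_sq_sub_const h2 yL).indicator hm).add
      ((integrable_sq_sub_const h2 yR).indicator hm.compl)
    refine this.congr (Eventually.of_forall fun z => ?_)
    by_cases hz : z.1 i ≤ a
    · simp [hz]
    · simp [hz]
  rw [splitLoss, ← integral_add_compl hm hint, compl_coord_le]
  congr 1
  · exact setIntegral_congr_fun hm fun z hz => by
      have : z.1 i ≤ a := hz
      simp [this]
  · exact setIntegral_congr_fun (measurableSet_lt_coord i a) fun z hz => by
      have : ¬ z.1 i ≤ a := not_le.2 hz
      simp [this]

namespace MomentConv

variable {ν : ℕ → Measure ((Fin d → ℝ) × ℝ)} {μ : Measure ((Fin d → ℝ) × ℝ)}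

theorem tendsto_loss (h : MomentConv ν μ) (c : ℝ) :
    Tendsto (fun k => ∫ z, (z.2 - c) ^ 2 ∂(ν k)) atTop (𝓝 (∫ z, (z.2 - c) ^ 2 ∂μ)) := by
  have := h.finite
  have := h.finite_lim
  rw [integral_sq_sub_const h.integrable_lim]
  simp_rw [fun k => integral_sq_sub_const (h.integrable k)]
  exact ((h.conv_univ le_rfl).sub ((h.conv_univ (by norm_num)).const_mul _)).add
    ((h.conv_univ (by norm_num)).const_mul _)

theorem tendsto_real_univ (h : MomentConv ν μ) :
    Tendsto (fun k => (ν k).real Set.univ) atTop (𝓝 (μ.real Set.univ)) := by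
  simpa [ratCell] using h.conv_mass []

theorem tendsto_splitLoss (h : MomentConv ν μ) (i : Fin d) {a : ℕ → ℝ} {b : ℝ}
    (ha : Tendsto a atTop (𝓝 b)) (yL yR : ℝ) :
    Tendsto (fun k => splitLoss (ν k) i (a k) yL yR) atTop (𝓝 (splitLoss μ i b yL yR)) := by
  have := h.finite
  have := h.finite_lim
  rw [splitLoss_eq h.integrable_lim]
  simp_rw [fun k => splitLoss_eq (h.integrable k)]
  exact ((h.restrict_le i ha).tendsto_loss yL).add ((h.restrict_lt i ha).tendsto_loss yR)

/-- In the limit, no sequence of constants does better than the best constant for the limit. -/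
theorem exists_const_loss_le (h : MomentConv ν μ) :
    ∃ c : ℝ, ∀ ε > 0, ∀ᶠ k in atTop, ∀ c' : ℝ,
      ∫ z, (z.2 - c) ^ 2 ∂μ - ε ≤ ∫ z, (z.2 - c') ^ 2 ∂(ν k) := by
  have := h.finite
  have hfin := h.finite_lim
  rcases eq_zero_or_neZero μ with h0 | h0
  · refine ⟨0, fun ε hε => Eventually.of_forall fun k c' => ?_⟩
    have : 0 ≤ ∫ z, (z.2 - c') ^ 2 ∂(ν k) := integral_nonneg fun z => sq_nonneg _
    simp only [h0, integral_zero_measure]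
    linarith
  · have hS0 : ∀ m : Measure ((Fin d → ℝ) × ℝ), ∫ z, z.2 ^ 0 ∂m = m.real Set.univ := by simp
    have hpos : 0 < μ.real Set.univ := by
      rw [measureReal_def]
      exact ENNReal.toReal_pos (by simpa using h0.out) (measure_ne_top _ _)
    -- Completing the square around the mean isolates the minimal loss, a continuous function of the
    -- moments at positive mass. This gives a bound uniform in `c'`, with no compactness of the
    -- constants.
    have hmin : ∀ m : Measure ((Fin d → ℝ) × ℝ), IsFiniteMeasure m →
        Integrable (fun z => z.2 ^ 2) m → 0 < m.real Set.univ → ∀ c' : ℝ,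
        ∫ z, (z.2 - c') ^ 2 ∂m = ∫ z, z.2 ^ 2 ∂m - (∫ z, z.2 ^ 1 ∂m) ^ 2 / m.real Set.univ
          + m.real Set.univ * (c' - (∫ z, z.2 ^ 1 ∂m) / m.real Set.univ) ^ 2 := by
      intro m _ hm hp c'
      rw [integral_sq_sub_const hm, hS0]
      field_simp
      ring
    have hlim : Tendsto
        (fun k => ∫ z, z.2 ^ 2 ∂(ν k) - (∫ z, z.2 ^ 1 ∂(ν k)) ^ 2 / (ν k).real Set.univ) atTop
        (𝓝 (∫ z, z.2 ^ 2 ∂μ - (∫ z, z.2 ^ 1 ∂μ) ^ 2 / μ.real Set.univ)) :=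
      (h.conv_univ le_rfl).sub
        (((h.conv_univ (by norm_num)).pow 2).div h.tendsto_real_univ hpos.ne')
    refine ⟨(∫ z, z.2 ^ 1 ∂μ) / μ.real Set.univ, fun ε hε => ?_⟩
    filter_upwards [hlim.eventually (lt_mem_nhds (sub_lt_self _ hε)),
      h.tendsto_real_univ.eventually (lt_mem_nhds hpos)] with k hk1 hk2 c'
    rw [hmin μ hfin h.integrable_lim hpos, hmin (ν k) (h.finite k) (h.integrable k) hk2]
    have : 0 ≤ (ν k).real Set.univ * (c' - (∫ z, z.2 ^ 1 ∂(ν k)) / (ν k).real Set.univ) ^ 2 := by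
      positivity
    simp only [sub_self]
    linarith

theorem eq_mean_of_loss_le {m : Measure ((Fin d → ℝ) × ℝ)} [IsFiniteMeasure m]
    (hm : Integrable (fun z => z.2 ^ 2) m) (hp : 0 < m.real Set.univ) {v : ℝ}
    (hv : ∀ c : ℝ, ∫ z, (z.2 - v) ^ 2 ∂m ≤ ∫ z, (z.2 - c) ^ 2 ∂m) :
    v = (∫ z, z.2 ^ 1 ∂m) / m.real Set.univ := by
  have hS0 : ∫ z : (Fin d → ℝ) × ℝ, z.2 ^ 0 ∂m = m.real Set.univ := by simp
  have h1 := hv ((∫ z, z.2 ^ 1 ∂m) / m.real Set.univ)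
  rw [integral_sq_sub_const hm, integral_sq_sub_const hm, hS0] at h1
  set A := ∫ z, z.2 ^ 1 ∂m
  set S := m.real Set.univ
  have h2 : S * (v - A / S) ^ 2 ≤ 0 := by
    have e : S * (v - A / S) ^ 2
      = (-(2 * v * A) + v ^ 2 * S) - (-(2 * (A / S) * A) + (A / S) ^ 2 * S) := by
      field_simp
      ring
    rw [e]
    linarith
  have h3 : (v - A / S) ^ 2 ≤ 0 := by
    by_contra hc
    exact absurd h2 (not_le.2 (mul_pos hp (not_le.1 hc)))
  have h4 := pow_eq_zero_iff (two_ne_zero) |>.1 (le_antisymm h3 (sq_nonneg _))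
  linarith

end MomentConv

theorem RegTree.measurable_eval {n : ℕ} (t : RegTree d n) : Measurable t.eval := by
  induction t with
  | leaf v => exact measurable_const
  | node i a L R ihL ihR =>
    exact Measurable.ite (measurableSet_le (by fun_prop) measurable_const) ihL ihR

theorem measureReal_le_restrict_add {E : Type*} [MeasurableSpace E] (m : Measure E)
    [IsFiniteMeasure m] {S A B U V : Set E} (hA : MeasurableSet A) (hB : MeasurableSet B)
    (hsub : S ⊆ (U ∩ A) ∪ (V ∩ B)) :
    m.real S ≤ (m.restrict A).real U + (m.restrict B).real V := by
  rw [measureReal_restrict_apply' hA, measureReal_restrict_apply' hB]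
  exact (measureReal_mono hsub).trans (measureReal_union_le _ _)

/-- Two splits disagree on `b < z.1 i ≤ a k` or on `a k < z.1 i ≤ b`. Restricting twice, the limit
of each mass is the mass of an empty set. -/
theorem MomentConv.tendsto_between {ν : ℕ → Measure ((Fin d → ℝ) × ℝ)}
    {μ : Measure ((Fin d → ℝ) × ℝ)} (h : MomentConv ν μ) (i : Fin d) {a : ℕ → ℝ} {b : ℝ}
    (ha : Tendsto a atTop (𝓝 b)) :
    Tendsto (fun k => (ν k).real {z | ¬ (z.1 i ≤ a k ↔ z.1 i ≤ b)}) atTop (𝓝 0) := by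
  have := h.finite
  have := h.finite_lim
  have hc : Tendsto (fun _ : ℕ => b) atTop (𝓝 b) := tendsto_const_nhds
  have e1 := ((h.restrict_le i ha).restrict_lt i hc).tendsto_real_univ
  have e2 := ((h.restrict_lt i ha).restrict_le i hc).tendsto_real_univ
  have z1 : ((μ.restrict {z | z.1 i ≤ b}).restrict {z | b < z.1 i}).real Set.univ = 0 := by
    rw [measureReal_restrict_apply MeasurableSet.univ, Set.univ_inter,
      measureReal_restrict_apply (measurableSet_lt_coord i b), ← compl_coord_le,
      Set.compl_inter_self, measureReal_empty]
  have z2 : ((μ.restrict {z | b < z.1 i}).restrict {z | z.1 i ≤ b}).real Set.univ = 0 := by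
    rw [measureReal_restrict_apply MeasurableSet.univ, Set.univ_inter,
      measureReal_restrict_apply (measurableSet_coord_le i b), ← compl_coord_le,
      Set.inter_compl_self, measureReal_empty]
  rw [z1] at e1
  rw [z2] at e2
  have e3 := e1.add e2
  rw [add_zero] at e3
  refine squeeze_zero (fun k => measureReal_nonneg) (fun k => ?_) e3
  simp only [measureReal_restrict_apply MeasurableSet.univ, Set.univ_inter,
    measureReal_restrict_apply (measurableSet_lt_coord i b),
    measureReal_restrict_apply (measurableSet_coord_le i b)]
  refine le_trans (measureReal_mono fun z hz => ?_) (measureReal_union_le _ _)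
  simp only [Set.mem_ofPred_eq, Set.mem_union, Set.mem_inter_iff] at hz ⊢
  by_cases h1 : z.1 i ≤ a k
  · by_cases h2 : z.1 i ≤ b
    · exact absurd (iff_of_true h1 h2) hz
    · exact Or.inl ⟨not_le.1 h2, h1⟩
  · by_cases h2 : z.1 i ≤ b
    · exact Or.inr ⟨h2, not_le.1 h1⟩
    · exact absurd (iff_of_false h1 h2) hz

/-- Limits of regression trees are regression trees for the limit. -/
theorem MomentConv.exists_limit_tree {n : ℕ} (s : SplitStrategy d n) :
    ∀ {ν : ℕ → Measure ((Fin d → ℝ) × ℝ)} {μ : Measure ((Fin d → ℝ) × ℝ)},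
      MomentConv ν μ → ∀ {l u : ℕ → Fin d → ℝ} {l' u' : Fin d → ℝ},
      Tendsto l atTop (𝓝 l') → Tendsto u atTop (𝓝 u') → ∀ t : ℕ → RegTree d n,
      (∀ k, IsRegTree (ν k) (l k) (u k) s (t k)) →
      ∃ φ : ℕ → ℕ, StrictMono φ ∧ ∃ t' : RegTree d n, IsRegTree μ l' u' s t' ∧
        ∀ ε > 0, Tendsto (fun k => (ν (φ k)).real {z | ε < |(t (φ k)).eval z.1 - t'.eval z.1|})
          atTop (𝓝 0) := by
  induction s with
  | nil =>
    intro ν μ h l u l' u' _ _ t ht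
    have := h.finite
    have hfin := h.finite_lim
    choose v hv using fun k => show ∃ v, t k = RegTree.leaf v from by
      cases t k with
      | leaf v => exact ⟨v, rfl⟩
    have hopt : ∀ k, ∀ c : ℝ, ∫ z, (z.2 - v k) ^ 2 ∂(ν k) ≤ ∫ z, (z.2 - c) ^ 2 ∂(ν k) := by
      intro k
      have := ht k
      rw [hv k] at this
      exact this
    refine ⟨id, strictMono_id, ?_⟩
    rcases eq_zero_or_neZero μ with h0 | h0
    -- On a leaf of zero limit mass the values need not converge, but the whole mass disappears, so
    -- any limit value will do.
    · refine ⟨RegTree.leaf 0, fun c => by simp [h0], fun ε hε => ?_⟩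
      have h1 := h.tendsto_real_univ
      rw [h0] at h1
      exact squeeze_zero (fun k => measureReal_nonneg)
        (fun k => measureReal_mono (Set.subset_univ _)) (by simpa using h1)
    · have hpos : 0 < μ.real Set.univ := by
        rw [measureReal_def]
        exact ENNReal.toReal_pos (by simpa using h0.out) (measure_ne_top _ _)
      have hvlim : Tendsto v atTop (𝓝 ((∫ z, z.2 ^ 1 ∂μ) / μ.real Set.univ)) := by
        refine Tendsto.congr' ?_
          ((h.conv_univ (r := 1) (by norm_num)).div h.tendsto_real_univ hpos.ne')
        filter_upwards [h.tendsto_real_univ.eventually (lt_mem_nhds hpos)] with k hk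
        exact (eq_mean_of_loss_le (h.integrable k) hk (hopt k)).symm
      set w := (∫ z, z.2 ^ 1 ∂μ) / μ.real Set.univ
      have hwopt : ∀ c : ℝ, ∫ z, (z.2 - w) ^ 2 ∂μ ≤ ∫ z, (z.2 - c) ^ 2 ∂μ := by
        intro c
        have hS0 : ∫ z : (Fin d → ℝ) × ℝ, z.2 ^ 0 ∂μ = μ.real Set.univ := by simp
        rw [integral_sq_sub_const h.integrable_lim, integral_sq_sub_const h.integrable_lim, hS0]
        have hw : ∫ z, z.2 ^ 1 ∂μ = w * μ.real Set.univ := (div_mul_cancel₀ _ hpos.ne').symm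
        rw [hw]
        nlinarith [mul_nonneg hpos.le (sq_nonneg (c - w))]
      refine ⟨RegTree.leaf w, hwopt, fun ε hε => ?_⟩
      refine Tendsto.congr' (f₁ := fun _ => 0) ?_ tendsto_const_nhds
      filter_upwards [hvlim.eventually (Metric.ball_mem_nhds w hε)] with k hk
      replace hk : |v k - w| < ε := hk
      simp [hv k, RegTree.eval, not_lt.2 hk.le]
  | @node n i mid sL sR ihL ihR =>
    intro ν μ h l u l' u' hl hu t ht
    choose i' a L R hnode using fun k =>
      show ∃ (i' : Fin d) (a : ℝ) (L R : RegTree d n), t k = RegTree.node i' a L R from by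
        cases t k with
        | node i' a L R => exact ⟨i', a, L, R, rfl⟩
    have ht' : ∀ k, IsRegTree (ν k) (l k) (u k) (.node i mid sL sR)
        (.node (i' k) (a k) (L k) (R k)) := fun k => hnode k ▸ ht k
    simp only [IsRegTree] at ht'
    have hli : Tendsto (fun k => l k i) atTop (𝓝 (l' i)) := (tendsto_pi_nhds.1 hl) i
    have hui : Tendsto (fun k => u k i) atTop (𝓝 (u' i)) := (tendsto_pi_nhds.1 hu) i
    -- a convergent subsequence of the thresholds
    have hsub : ∃ φ : ℕ → ℕ, StrictMono φ ∧ ∃ b : ℝ, Tendsto (a ∘ φ) atTop (𝓝 b) ∧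
        (if mid = true then b = (l' i + u' i) / 2
        else b ∈ Set.Icc (l' i) (u' i) ∧
          ∃ yL yR : ℝ, ∀ a' ∈ Set.Icc (l' i) (u' i), ∀ yL' yR' : ℝ,
            splitLoss μ i b yL yR ≤ splitLoss μ i a' yL' yR') := by
      cases mid with
      | true =>
        refine ⟨id, strictMono_id, (l' i + u' i) / 2, ?_, by simp⟩
        have : a = fun k => (l k i + u k i) / 2 := funext fun k => by simpa using (ht' k).2.1
        rw [this]
        exact (hli.add hui).div_const 2
      | false =>
        simp only [Bool.false_eq_true, if_false] at ht' ⊢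
        have hmem := fun k => (ht' k).2.1.1
        obtain ⟨A, hA⟩ := hli.bddBelow_range
        obtain ⟨B, hB⟩ := hui.bddAbove_range
        obtain ⟨b, -, φ, hφ, hb⟩ := (isCompact_Icc (a := A) (b := B)).tendsto_subseq
          (fun k => ⟨(hA ⟨k, rfl⟩).trans (hmem k).1, (hmem k).2.trans (hB ⟨k, rfl⟩)⟩)
        refine ⟨φ, hφ, b, hb, ⟨le_of_tendsto_of_tendsto' (hli.comp hφ.tendsto_atTop) hb
          fun k => (hmem _).1, le_of_tendsto_of_tendsto' hb (hui.comp hφ.tendsto_atTop)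
          fun k => (hmem _).2⟩, ?_⟩
        have hν := h.comp hφ.tendsto_atTop
        have hfin := hν.finite
        have hfin' := hν.finite_lim
        -- The optimal values for `ν k` may be unbounded on a half of vanishing mass, so no limit of
        -- them is taken; the best constants for the limiting halves are used instead.
        obtain ⟨yL, hyL⟩ := (hν.restrict_le i hb).exists_const_loss_le
        obtain ⟨yR, hyR⟩ := (hν.restrict_lt i hb).exists_const_loss_le
        refine ⟨yL, yR, fun a' ha' zL zR => ?_⟩
        -- A competitor `a'` in the limit cell may lie outside the `k`-th cell; its projection onto
        -- that cell is admissible and tends to `a'`.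
        have hclamp : Tendsto (fun k => max (l (φ k) i) (min (u (φ k) i) a')) atTop (𝓝 a') := by
          have := (hli.comp hφ.tendsto_atTop).max
            ((hui.comp hφ.tendsto_atTop).min (tendsto_const_nhds (x := a')))
          rwa [min_eq_right ha'.2, max_eq_right ha'.1] at this
        have hloss := hν.tendsto_splitLoss i hclamp zL zR
        refine le_of_forall_pos_le_add fun ε hε => ?_
        have hev : ∀ᶠ k in atTop, splitLoss μ i b yL yR - ε
            ≤ splitLoss (ν (φ k)) i (max (l (φ k) i) (min (u (φ k) i) a')) zL zR := by
          filter_upwards [hyL (ε / 2) (half_pos hε), hyR (ε / 2) (half_pos hε)] with k h1 h2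
          obtain ⟨wL, wR, hw⟩ := (ht' (φ k)).2.1.2
          refine le_trans ?_ (hw _ ⟨le_max_left _ _, max_le ((hmem (φ k)).1.trans (hmem (φ k)).2)
            (min_le_left _ _)⟩ zL zR)
          rw [splitLoss_eq h.integrable_lim, splitLoss_eq (h.integrable (φ k))]
          have e1 := h1 wL
          have e2 := h2 wR
          simp only [Function.comp_apply] at e1 e2
          linarith
        have := ge_of_tendsto hloss hev
        linarith
    obtain ⟨φ, hφ, b, hb, hopt⟩ := hsub
    have hν := h.comp hφ.tendsto_atTop
    have hlφ := hl.comp hφ.tendsto_atTop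
    have huφ := hu.comp hφ.tendsto_atTop
    obtain ⟨φ₁, hφ₁, L', hL', hLlim⟩ := ihL (hν.restrict_le i hb) hlφ
      (huφ.update i hb) (fun k => L (φ k)) (fun k => (ht' (φ k)).2.2.1)
    have hφφ₁ := hφ₁.tendsto_atTop
    -- The right subtree is treated along the subsequence already extracted for the left one.
    obtain ⟨φ₂, hφ₂, R', hR', hRlim⟩ := ihR
      ((hν.comp hφφ₁).restrict_lt i (hb.comp hφφ₁)) ((hlφ.update i hb).comp hφφ₁)
      (huφ.comp hφφ₁) (fun k => R (φ (φ₁ k))) (fun k => (ht' (φ (φ₁ k))).2.2.2)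
    refine ⟨fun k => φ (φ₁ (φ₂ k)), hφ.comp (hφ₁.comp hφ₂), RegTree.node i b L' R',
      ⟨rfl, hopt, hL', hR'⟩, fun ε hε => ?_⟩
    have hψ := hφφ₁.comp hφ₂.tendsto_atTop
    have hbet := (hν.comp hψ).tendsto_between i (hb.comp hψ)
    have hsum := (((hLlim ε hε).comp hφ₂.tendsto_atTop).add (hRlim ε hε)).add hbet
    simp only [add_zero] at hsum
    have hfin := h.finite
    refine squeeze_zero (fun k => measureReal_nonneg) (fun k => ?_) hsum
    simp only [Function.comp_apply]
    rw [measureReal_restrict_apply' (measurableSet_coord_le _ _),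
      measureReal_restrict_apply' (measurableSet_lt_coord _ _)]
    refine le_trans (measureReal_mono fun z hz => ?_)
      ((measureReal_union_le _ _).trans (add_le_add_left (measureReal_union_le _ _) _))
    rw [hnode, (ht' _).1] at hz
    simp only [RegTree.eval, Set.mem_ofPred_eq] at hz
    simp only [Set.mem_union, Set.mem_inter_iff, Set.mem_ofPred_eq]
    by_cases h1 : z.1 i ≤ a (φ (φ₁ (φ₂ k)))
    · by_cases h2 : z.1 i ≤ b
      · rw [if_pos h1, if_pos h2] at hz
        exact Or.inl (Or.inl ⟨hz, h1⟩)
      · exact Or.inr fun h3 => h2 (h3.1 h1)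
    · by_cases h2 : z.1 i ≤ b
      · exact Or.inr fun h3 => h1 (h3.2 h2)
      · rw [if_neg h1, if_neg h2] at hz
        exact Or.inl (Or.inr ⟨hz, not_le.1 h1⟩)

/-- A `μ`-null set need not be negligible for the `ν k`, but this one is a finite union of cells.
Splitting down to the leaves leaves either the empty set or the full space, whose mass converges to
0. -/
theorem MomentConv.tendsto_real_ne_const {n : ℕ} (v : ℝ) (t : RegTree d n) :
    ∀ {ν : ℕ → Measure ((Fin d → ℝ) × ℝ)} {μ : Measure ((Fin d → ℝ) × ℝ)},
      MomentConv ν μ → μ {z | v ≠ t.eval z.1} = 0 →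
      Tendsto (fun k => (ν k).real {z | v ≠ t.eval z.1}) atTop (𝓝 0) := by
  induction t with
  | leaf w =>
    intro ν μ h h0
    simp only [RegTree.eval] at h0 ⊢
    by_cases hvw : v = w
    · simp [hvw]
    · simp only [ne_eq, hvw, not_false_eq_true, Set.ofPred_true] at h0 ⊢
      have := h.tendsto_real_univ
      rwa [measureReal_def, h0, ENNReal.toReal_zero] at this
  | node i a L R ihL ihR =>
    intro ν μ h h0
    have hfin := h.finite
    have hc : Tendsto (fun _ : ℕ => a) atTop (𝓝 a) := tendsto_const_nhds
    have hL := ihL (h.restrict_le i hc) (by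
      rw [Measure.restrict_apply' (measurableSet_coord_le i a)]
      refine measure_mono_null (fun z hz => ?_) h0
      have h2 : z.1 i ≤ a := hz.2
      simpa [RegTree.eval, h2] using hz.1)
    have hR := ihR (h.restrict_lt i hc) (by
      rw [Measure.restrict_apply' (measurableSet_lt_coord i a)]
      refine measure_mono_null (fun z hz => ?_) h0
      have h2 : ¬ z.1 i ≤ a := not_le.2 hz.2
      simpa [RegTree.eval, h2] using hz.1)
    have hsum := hL.add hR
    rw [add_zero] at hsum
    refine squeeze_zero (fun k => measureReal_nonneg) (fun k => ?_) hsum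
    refine measureReal_le_restrict_add (ν k) (measurableSet_coord_le i a)
      (measurableSet_lt_coord i a) fun z hz => ?_
    by_cases h2 : z.1 i ≤ a
    · exact Or.inl ⟨by simpa [RegTree.eval, h2] using hz, h2⟩
    · exact Or.inr ⟨by simpa [RegTree.eval, h2] using hz, not_le.1 h2⟩

theorem MomentConv.tendsto_real_eval_ne {n m : ℕ} (t : RegTree d n) (t' : RegTree d m) :
    ∀ {ν : ℕ → Measure ((Fin d → ℝ) × ℝ)} {μ : Measure ((Fin d → ℝ) × ℝ)},
      MomentConv ν μ → μ {z | t.eval z.1 ≠ t'.eval z.1} = 0 →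
      Tendsto (fun k => (ν k).real {z | t.eval z.1 ≠ t'.eval z.1}) atTop (𝓝 0) := by
  induction t with
  | leaf w => exact MomentConv.tendsto_real_ne_const w t'
  | node i a L R ihL ihR =>
    intro ν μ h h0
    have hfin := h.finite
    have hc : Tendsto (fun _ : ℕ => a) atTop (𝓝 a) := tendsto_const_nhds
    have hL := ihL (h.restrict_le i hc) (by
      rw [Measure.restrict_apply' (measurableSet_coord_le i a)]
      refine measure_mono_null (fun z hz => ?_) h0
      have h2 : z.1 i ≤ a := hz.2
      simpa [RegTree.eval, h2] using hz.1)
    have hR := ihR (h.restrict_lt i hc) (by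
      rw [Measure.restrict_apply' (measurableSet_lt_coord i a)]
      refine measure_mono_null (fun z hz => ?_) h0
      have h2 : ¬ z.1 i ≤ a := not_le.2 hz.2
      simpa [RegTree.eval, h2] using hz.1)
    have hsum := hL.add hR
    rw [add_zero] at hsum
    refine squeeze_zero (fun k => measureReal_nonneg) (fun k => ?_) hsum
    refine measureReal_le_restrict_add (ν k) (measurableSet_coord_le i a)
      (measurableSet_lt_coord i a) fun z hz => ?_
    by_cases h2 : z.1 i ≤ a
    · exact Or.inl ⟨by simpa [RegTree.eval, h2] using hz, h2⟩
    · exact Or.inr ⟨by simpa [RegTree.eval, h2] using hz, not_le.1 h2⟩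

/-- Consistency of regression trees when the regression tree for the limit is unique. -/
theorem MomentConv.tendsto_tree {n : ℕ} {s : SplitStrategy d n}
    {ν : ℕ → Measure ((Fin d → ℝ) × ℝ)} {μ : Measure ((Fin d → ℝ) × ℝ)} (h : MomentConv ν μ)
    {l u : Fin d → ℝ} {t : ℕ → RegTree d n} (ht : ∀ k, IsRegTree (ν k) l u s (t k))
    {T : RegTree d n} (hT : ∀ t' : RegTree d n, IsRegTree μ l u s t' →
      μ {z | t'.eval z.1 ≠ T.eval z.1} = 0) {ε : ℝ} (hε : 0 < ε) :
    Tendsto (fun k => (ν k).real {z | ε < |(t k).eval z.1 - T.eval z.1|}) atTop (𝓝 0) := by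
  -- The limit tree may depend on the subsequence, but by `hT` it always agrees with `T` off a
  -- `μ`-null set.
  refine tendsto_of_subseq_tendsto fun ns hns => ?_
  obtain ⟨φ, hφ, t', ht', hlim⟩ := MomentConv.exists_limit_tree s (h.comp hns)
    (tendsto_const_nhds (x := l)) (tendsto_const_nhds (x := u)) (fun k => t (ns k))
    fun k => ht (ns k)
  refine ⟨φ, ?_⟩
  have hne := MomentConv.tendsto_real_eval_ne t' T
    ((h.comp hns).comp hφ.tendsto_atTop) (hT t' ht')
  have hsum := (hlim ε hε).add hne
  rw [add_zero] at hsum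
  have hfin := h.finite
  refine squeeze_zero (fun k => measureReal_nonneg) (fun k => ?_) hsum
  refine le_trans (measureReal_mono fun z hz => ?_) (measureReal_union_le _ _)
  by_cases h2 : t'.eval z.1 = T.eval z.1
  · left
    simpa [h2] using hz
  · exact Or.inr h2

end Loss

/-! ### Sample means and mean-square closeness -/

section Average

/-- The mean of the first `M` terms of a sequence. -/
noncomputable def avg (M : ℕ) (f : ℕ → ℝ) : ℝ := (M : ℝ)⁻¹ * ∑ m ∈ Finset.range M, f m

theorem avg_mono {M : ℕ} {f g : ℕ → ℝ} (h : ∀ m, f m ≤ g m) : avg M f ≤ avg M g :=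
  mul_le_mul_of_nonneg_left (Finset.sum_le_sum fun m _ => h m) (by positivity)

theorem avg_nonneg {M : ℕ} {f : ℕ → ℝ} (h : ∀ m, 0 ≤ f m) : 0 ≤ avg M f :=
  mul_nonneg (by positivity) (Finset.sum_nonneg fun m _ => h m)

theorem avg_add (M : ℕ) (f g : ℕ → ℝ) : avg M (fun m => f m + g m) = avg M f + avg M g := by
  simp only [avg, Finset.sum_add_distrib, mul_add]

theorem avg_sub (M : ℕ) (f g : ℕ → ℝ) : avg M (fun m => f m - g m) = avg M f - avg M g := by
  simp only [avg, Finset.sum_sub_distrib, mul_sub]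

theorem avg_const_mul (M : ℕ) (c : ℝ) (f : ℕ → ℝ) : avg M (fun m => c * f m) = c * avg M f := by
  simp only [avg, ← Finset.mul_sum]
  ring

/-- Only an inequality, since the mean is 0 at `M = 0`. -/
theorem avg_one_le (M : ℕ) : avg M (fun _ => 1) ≤ 1 := by
  rcases Nat.eq_zero_or_pos M with rfl | hM
  · simp [avg]
  · have : (M : ℝ) ≠ 0 := by positivity
    simp [avg, this]

theorem abs_avg_le (M : ℕ) (f : ℕ → ℝ) : |avg M f| ≤ avg M fun m => |f m| := by
  rw [avg, avg, abs_mul, abs_of_nonneg (show (0 : ℝ) ≤ (M : ℝ)⁻¹ by positivity)]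
  exact mul_le_mul_of_nonneg_left (Finset.abs_sum_le_sum_abs _ _) (by positivity)

/-- Young's inequality with weight `η`, applied for `r = 2` to the cross term of `a ^ 2 - b ^ 2 = (a
- b) ^ 2 + 2 * (a - b) * b`. -/
theorem abs_pow_sub_pow_le_sq_add {r : ℕ} (hr : r ≤ 2) {η : ℝ} (hη : 0 < η) (a b : ℝ) :
    |a ^ r - b ^ r| ≤ (1 + η⁻¹) * (a - b) ^ 2 + η * (1 + b ^ 2) := by
  have key : ∀ y : ℝ, 2 * |a - b| * |y| ≤ η⁻¹ * (a - b) ^ 2 + η * y ^ 2 := by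
    intro y
    have h1 : 0 ≤ η⁻¹ * (|a - b| - η * |y|) ^ 2 := by positivity
    have h2 : η⁻¹ * (|a - b| - η * |y|) ^ 2
        = η⁻¹ * |a - b| ^ 2 - 2 * |a - b| * |y| + η * |y| ^ 2 := by
      field_simp
      ring
    rw [h2, sq_abs, sq_abs] at h1
    linarith
  have hsq := sq_nonneg (a - b)
  interval_cases r
  · simp only [pow_zero, sub_self, abs_zero]
    positivity
  · have := key 1
    have h3 : 0 ≤ η * b ^ 2 := by positivity
    rw [abs_one] at this
    simp only [pow_one]
    nlinarith [abs_nonneg (a - b)]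
  · have := key b
    have h4 : |a ^ 2 - b ^ 2| ≤ (a - b) ^ 2 + 2 * |a - b| * |b| := by
      have : a ^ 2 - b ^ 2 = (a - b) ^ 2 + 2 * (a - b) * b := by ring
      rw [this]
      refine (abs_add_le _ _).trans (le_of_eq ?_)
      rw [abs_of_nonneg hsq, abs_mul, abs_mul, abs_two]
    nlinarith

/-- Mean-square closeness of two arrays yields closeness of their first two moments. -/
theorem tendsto_avg_abs_pow_sub {a : ℕ → ℕ → ℝ} {b : ℕ → ℝ} {L : ℝ}
    (hab : Tendsto (fun M => avg M fun m => (a M m - b m) ^ 2) atTop (𝓝 0))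
    (hb : Tendsto (fun M => avg M fun m => b m ^ 2) atTop (𝓝 L)) {r : ℕ} (hr : r ≤ 2) :
    Tendsto (fun M => avg M fun m => |a M m ^ r - b m ^ r|) atTop (𝓝 0) := by
  have hL : 0 ≤ L := ge_of_tendsto' hb fun M => avg_nonneg fun m => sq_nonneg _
  rw [Metric.tendsto_nhds]
  intro ε hε
  obtain ⟨η, hη, hηε⟩ : ∃ η : ℝ, 0 < η ∧ η * (1 + L) < ε := by
    refine ⟨ε / (2 * (1 + L)), by positivity, ?_⟩
    have : ε / (2 * (1 + L)) * (1 + L) = ε / 2 := by field_simp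
    rw [this]
    linarith
  have hlim : Tendsto (fun M => (1 + η⁻¹) * (avg M fun m => (a M m - b m) ^ 2)
      + η * (1 + avg M fun m => b m ^ 2)) atTop (𝓝 ((1 + η⁻¹) * 0 + η * (1 + L))) :=
    (hab.const_mul _).add ((hb.const_add 1).const_mul η)
  rw [mul_zero, zero_add] at hlim
  filter_upwards [hlim.eventually (gt_mem_nhds hηε)] with M hM
  have h0 : 0 ≤ avg M fun m => |a M m ^ r - b m ^ r| := avg_nonneg fun m => abs_nonneg _
  rw [Real.dist_eq, sub_zero, abs_of_nonneg h0]
  refine lt_of_le_of_lt ((avg_mono fun m => abs_pow_sub_pow_le_sq_add hr hη (a M m) (b m)).trans ?_) hM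
  rw [avg_add, avg_const_mul, avg_const_mul, avg_add]
  have := avg_one_le M
  gcongr

end Average

/-! ### Empirical measures -/

section Empirical

variable {E : Type*} [MeasurableSpace E]

/-- The weight is infinite at `M = 0`, but it multiplies an empty sum. -/
theorem empMeasure_zero (g : ℕ → E) : empMeasure 0 g = 0 := by
  simp [empMeasure]

instance isFiniteMeasure_empMeasure (M : ℕ) (g : ℕ → E) : IsFiniteMeasure (empMeasure M g) := by
  rcases Nat.eq_zero_or_pos M with rfl | hM
  · rw [empMeasure_zero]
    infer_instance
  · refine Measure.smul_finite _ ?_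
    simp [hM.ne']

theorem integrable_empMeasure [MeasurableSingletonClass E] (M : ℕ) (g : ℕ → E) (f : E → ℝ) :
    Integrable f (empMeasure M g) := by
  rcases Nat.eq_zero_or_pos M with rfl | hM
  · rw [empMeasure_zero]
    exact integrable_zero_measure
  · refine Integrable.smul_measure ?_ (by simp [hM.ne'])
    exact integrable_finsetSum_measure.2 fun m _ => integrable_dirac (by simp)

theorem integral_empMeasure [MeasurableSingletonClass E] (M : ℕ) (g : ℕ → E) (f : E → ℝ) :
    ∫ z, f z ∂(empMeasure M g) = avg M fun m => f (g m) := by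
  rw [empMeasure, integral_smul_measure,
    integral_finsetSum_measure fun m _ => integrable_dirac (by simp), avg]
  simp

theorem real_empMeasure [MeasurableSingletonClass E] (M : ℕ) (g : ℕ → E) {S : Set E}
    (hS : MeasurableSet S) :
    (empMeasure M g).real S = avg M fun m => S.indicator (fun _ => 1) (g m) := by
  rw [← integral_empMeasure, integral_indicator hS]
  simp

end Empirical

/-! ### Comparison of two exercise policies along a path -/

section Policy

variable {d N p : ℕ}

theorem policyPayoff_last (h : Fin (N + 1) → (Fin d → ℝ) → ℝ) (T : Fin N → RegTree d p)
    (x : Fin (N + 1) → Fin d → ℝ) :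
    policyPayoff h T x (Fin.last N) = h (Fin.last N) (x (Fin.last N)) := by
  simp [policyPayoff, exerciseIndex, Fin.reverseInduction_last]

theorem policyPayoff_castSucc (h : Fin (N + 1) → (Fin d → ℝ) → ℝ) (T : Fin N → RegTree d p)
    (x : Fin (N + 1) → Fin d → ℝ) (j : Fin N) :
    policyPayoff h T x j.castSucc =
      if (T j).eval (x j.castSucc) ≤ h j.castSucc (x j.castSucc)
        then h j.castSucc (x j.castSucc) else policyPayoff h T x j.succ := by
  simp only [policyPayoff, exerciseIndex, Fin.reverseInduction_castSucc]
  split_ifs <;> rfl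

theorem measurable_policyPayoff {h : Fin (N + 1) → (Fin d → ℝ) → ℝ} (hh : ∀ j, Measurable (h j))
    (T : Fin N → RegTree d p) (j : Fin (N + 1)) :
    Measurable fun x : Fin (N + 1) → Fin d → ℝ => policyPayoff h T x j := by
  have hz : ∀ k, Measurable fun x : Fin (N + 1) → Fin d → ℝ => h k (x k) := fun k =>
    (hh k).comp (measurable_pi_apply k)
  induction j using Fin.reverseInduction with
  | last => simpa only [policyPayoff_last] using hz _
  | cast j ih =>
    simp only [policyPayoff_castSucc]
    exact Measurable.ite (measurableSet_le
      ((T j).measurable_eval.comp (measurable_pi_apply _)) (hz _)) (hz _) ih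

/-- The envelope does not depend on the trees, hence controls the tails of all estimated policies at
once. -/
theorem policyPayoff_sq_le (h : Fin (N + 1) → (Fin d → ℝ) → ℝ) (T : Fin N → RegTree d p)
    (x : Fin (N + 1) → Fin d → ℝ) (j : Fin (N + 1)) :
    policyPayoff h T x j ^ 2 ≤ ∑ k, h k (x k) ^ 2 :=
  Finset.single_le_sum (f := fun k => h k (x k) ^ 2) (fun _ _ => sq_nonneg _)
    (Finset.mem_univ (exerciseIndex h (fun i => (T i).eval) x j))

/-- One backward step: the error only increases where the two policies decide differently. -/
theorem policyPayoff_sub_sq_le (h : Fin (N + 1) → (Fin d → ℝ) → ℝ) (T T' : Fin N → RegTree d p)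
    (x : Fin (N + 1) → Fin d → ℝ) (j : Fin N) {ε K : ℝ} (hK : 0 ≤ K) :
    (policyPayoff h T' x j.castSucc - policyPayoff h T x j.castSucc) ^ 2 ≤
      (policyPayoff h T' x j.succ - policyPayoff h T x j.succ) ^ 2 +
      4 * (K * {y : Fin d → ℝ | ε < |(T' j).eval y - (T j).eval y|}.indicator (fun _ => 1)
            (x j.castSucc)
        + K * {y : Fin d → ℝ | |h j.castSucc y - (T j).eval y| ≤ ε}.indicator (fun _ => 1)
            (x j.castSucc)
        + {y : Fin (N + 1) → Fin d → ℝ | K < ∑ k, h k (y k) ^ 2}.indicator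
            (fun y => ∑ k, h k (y k) ^ 2) x) := by
  set G := ∑ k, h k (x k) ^ 2 with hG
  have hG0 : 0 ≤ G := Finset.sum_nonneg fun k _ => sq_nonneg _
  have hi : ∀ (A : Set (Fin d → ℝ)) (y : Fin d → ℝ),
      0 ≤ K * A.indicator (fun _ => (1 : ℝ)) y := fun A y =>
    mul_nonneg hK (Set.indicator_nonneg (fun _ _ => zero_le_one) _)
  have hi3 : 0 ≤ {y : Fin (N + 1) → Fin d → ℝ | K < ∑ k, h k (y k) ^ 2}.indicator
      (fun y => ∑ k, h k (y k) ^ 2) x :=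
    Set.indicator_nonneg (fun y _ => Finset.sum_nonneg fun k _ => sq_nonneg _) _
  have hGK : G ≤ K + {y : Fin (N + 1) → Fin d → ℝ | K < ∑ k, h k (y k) ^ 2}.indicator
      (fun y => ∑ k, h k (y k) ^ 2) x := by
    by_cases hKG : K < G
    · rw [Set.indicator_of_mem (show x ∈ {y | K < ∑ k, h k (y k) ^ 2} from hKG)]
      linarith
    · linarith
  have h1 := hi {y | ε < |(T' j).eval y - (T j).eval y|} (x j.castSucc)
  have h2 := hi {y | |h j.castSucc y - (T j).eval y| ≤ ε} (x j.castSucc)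
  by_cases hdec : (T' j).eval (x j.castSucc) ≤ h j.castSucc (x j.castSucc) ↔
      (T j).eval (x j.castSucc) ≤ h j.castSucc (x j.castSucc)
  · have h3 : (policyPayoff h T' x j.castSucc - policyPayoff h T x j.castSucc) ^ 2
        ≤ (policyPayoff h T' x j.succ - policyPayoff h T x j.succ) ^ 2 := by
      rw [policyPayoff_castSucc, policyPayoff_castSucc]
      by_cases hc : (T j).eval (x j.castSucc) ≤ h j.castSucc (x j.castSucc)
      · rw [if_pos (hdec.2 hc), if_pos hc, sub_self]
        simpa using sq_nonneg _
      · rw [if_neg fun hc' => hc (hdec.1 hc'), if_neg hc]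
    linarith
  · have h3 : (policyPayoff h T' x j.castSucc - policyPayoff h T x j.castSucc) ^ 2 ≤ 4 * G := by
      -- The factor 4 comes from `(a - b) ^ 2 ≤ 2 * a ^ 2 + 2 * b ^ 2`.
      have e1 := policyPayoff_sq_le h T' x j.castSucc
      have e2 := policyPayoff_sq_le h T x j.castSucc
      nlinarith [sq_nonneg (policyPayoff h T' x j.castSucc + policyPayoff h T x j.castSucc)]
    have h4 := sq_nonneg (policyPayoff h T' x j.succ - policyPayoff h T x j.succ)
    -- If the payoff is more than `ε` away from `T j` and the trees are within `ε`, it lies on the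
    -- same side of both.
    have h5 : x j.castSucc ∈ {y : Fin d → ℝ | ε < |(T' j).eval y - (T j).eval y|} ∨
        x j.castSucc ∈ {y : Fin d → ℝ | |h j.castSucc y - (T j).eval y| ≤ ε} := by
      by_contra! hcon
      have c1 : |(T' j).eval (x j.castSucc) - (T j).eval (x j.castSucc)| ≤ ε :=
        not_lt.1 hcon.1
      have c2 : ε < |h j.castSucc (x j.castSucc) - (T j).eval (x j.castSucc)| :=
        not_le.1 hcon.2
      rw [abs_le] at c1
      apply hdec
      rcases lt_abs.1 c2 with c3 | c3
      · exact iff_of_true (by linarith [c1.2]) (by linarith [c1.1, c1.2])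
      · exact iff_of_false (by linarith [c1.1]) (by linarith [c1.1, c1.2])
    rcases h5 with h5 | h5
    · rw [Set.indicator_of_mem h5]
      linarith
    · rw [Set.indicator_of_mem h5]
      linarith

end Policy

/-! ### Strong laws and the backward induction -/

section Consistency

theorem ae_tendsto_avg_comp {Ω E : Type*} [MeasurableSpace Ω] [MeasurableSpace E] {P : Measure Ω}
    {Y : Ω → E} {Ys : ℕ → Ω → E} (hindep : iIndepFun Ys P)
    (hident : ∀ m, IdentDistrib (Ys m) Y P P) {F : E → ℝ} (hF : Measurable F)
    (hint : Integrable (fun ω => F (Y ω)) P) :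
    ∀ᵐ ω ∂P, Tendsto (fun M => avg M fun m => F (Ys m ω)) atTop (𝓝 (∫ ω, F (Y ω) ∂P)) := by
  have hid : ∀ m, IdentDistrib (fun ω => F (Ys m ω)) (fun ω => F (Y ω)) P P := fun m =>
    (hident m).comp hF
  have h := strong_law_ae_real (fun m ω => F (Ys m ω)) ((hid 0).integrable_iff.2 hint)
    (fun i j hij => (hindep.indepFun hij).comp hF hF) fun m => (hid m).trans (hid 0).symm
  filter_upwards [h] with ω hω
  rw [(hid 0).integral_eq] at hω
  simpa only [avg, div_eq_inv_mul] using hω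

variable {Ω : Type*} [MeasurableSpace Ω] {P : Measure Ω} {d N p : ℕ}
  {X : Fin (N + 1) → Ω → Fin d → ℝ} {h : Fin (N + 1) → (Fin d → ℝ) → ℝ}

theorem measurable_path (hX : ∀ j, Measurable (X j)) : Measurable fun ω k => X k ω :=
  measurable_pi_lambda _ hX

theorem integrable_payoff_sq_sum (hL2 : ∀ j, MemLp (fun ω => h j (X j ω)) 2 P) :
    Integrable (fun ω => ∑ k, h k (X k ω) ^ 2) P :=
  integrable_finsetSum _ fun k _ => (hL2 k).integrable_sq

theorem integrable_policyPayoff_sq (hX : ∀ j, Measurable (X j)) (hh : ∀ j, Measurable (h j))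
    (hL2 : ∀ j, MemLp (fun ω => h j (X j ω)) 2 P) (T : Fin N → RegTree d p) (j : Fin (N + 1)) :
    Integrable (fun ω => policyPayoff h T (fun k => X k ω) j ^ 2) P := by
  refine (integrable_payoff_sq_sum hL2).mono'
    (((measurable_policyPayoff hh T j).comp (measurable_path hX)).pow_const 2).aestronglyMeasurable
    (Eventually.of_forall fun ω => ?_)
  rw [Real.norm_eq_abs, abs_of_nonneg (sq_nonneg _)]
  exact policyPayoff_sq_le h T _ j

theorem measurable_data (hX : ∀ j, Measurable (X j)) (hh : ∀ j, Measurable (h j))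
    (T : Fin N → RegTree d p) (j : Fin N) :
    Measurable fun ω => (X j.castSucc ω, policyPayoff h T (fun k => X k ω) j.succ) :=
  (hX _).prodMk ((measurable_policyPayoff hh T _).comp (measurable_path hX))

/-- Cells constrain only the regressor, which does not depend on the policy. Passing to the
theoretical responses thus keeps cell membership, and costs an error controlled by `hsucc`. -/
theorem momentConv_empiricalData [IsProbabilityMeasure P] (hX : ∀ j, Measurable (X j))
    (hh : ∀ j, Measurable (h j)) (hL2 : ∀ j, MemLp (fun ω => h j (X j ω)) 2 P)
    {T : Fin N → RegTree d p} {j : Fin N} (hdens : P.map (X j.castSucc) ≪ volume)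
    {x : ℕ → Fin (N + 1) → Fin d → ℝ}
    (hcell : ∀ c : List (Fin d × ℚ × Bool), ∀ r ≤ 2, Tendsto (fun M => avg M fun m =>
      (ratCell c).indicator (fun z => z.2 ^ r)
        (x m j.castSucc, policyPayoff h T (x m) j.succ)) atTop
      (𝓝 (∫ ω, (ratCell c).indicator (fun z => z.2 ^ r)
        (X j.castSucc ω, policyPayoff h T (fun k => X k ω) j.succ) ∂P)))
    {T' : ℕ → Fin N → RegTree d p}
    (hsucc : Tendsto (fun M => avg M fun m =>
      (policyPayoff h (T' M) (x m) j.succ - policyPayoff h T (x m) j.succ) ^ 2) atTop (𝓝 0)) :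
    MomentConv (fun M => empiricalData h (T' M) M x j) (theoreticalData P h T X j) := by
  have hdata := measurable_data hX hh T j
  refine ⟨fun M => isFiniteMeasure_empMeasure _ _, Measure.isFiniteMeasure_map _ _,
    fun M => integrable_empMeasure _ _ _, ?_, fun i a => ?_, fun c r hr => ?_⟩
  · rw [theoreticalData, integrable_map_measure (by fun_prop) hdata.aemeasurable]
    exact integrable_policyPayoff_sq hX hh hL2 T j.succ
  · have h0 : P.map (X j.castSucc) {y | y i = a} = 0 := hdens (by
      rw [volume_pi]
      exact Measure.pi_hyperplane (fun _ : Fin d => (volume : Measure ℝ)) i a)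
    have hm : MeasurableSet {y : Fin d → ℝ | y i = a} :=
      measurableSet_eq_fun (measurable_pi_apply i) measurable_const
    rw [Measure.map_apply (hX _) hm] at h0
    rw [theoreticalData, Measure.map_apply hdata
      (show MeasurableSet {z : (Fin d → ℝ) × ℝ | z.1 i = a} from measurable_fst hm)]
    exact h0
  · have hc := measurableSet_ratCell c
    rw [← integral_indicator hc, theoreticalData, integral_map hdata.aemeasurable
      (Measurable.indicator (by fun_prop) hc).aestronglyMeasurable]
    simp_rw [← integral_indicator hc, empiricalData, integral_empMeasure]
    have hb := hcell [] 2 le_rfl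
    simp only [ratCell, Set.indicator_univ] at hb
    have hdiff := tendsto_avg_abs_pow_sub hsucc hb hr
    have hzero := squeeze_zero_norm (f := fun M => (avg M fun m =>
        (ratCell c).indicator (fun z => z.2 ^ r)
          (x m j.castSucc, policyPayoff h (T' M) (x m) j.succ)) - avg M fun m =>
        (ratCell c).indicator (fun z => z.2 ^ r)
          (x m j.castSucc, policyPayoff h T (x m) j.succ)) (fun M => ?_) hdiff
    · simpa using hzero.add (hcell c r hr)
    · rw [← avg_sub, Real.norm_eq_abs]
      refine (abs_avg_le _ _).trans (avg_mono fun m => ?_)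
      have hiff : (x m j.castSucc, policyPayoff h (T' M) (x m) j.succ) ∈ ratCell c ↔
          (x m j.castSucc, policyPayoff h T (x m) j.succ) ∈ ratCell c := mem_ratCell_congr rfl
      by_cases hm : (x m j.castSucc, policyPayoff h T (x m) j.succ) ∈ ratCell c
      · rw [Set.indicator_of_mem hm, Set.indicator_of_mem (hiff.2 hm)]
      · rw [Set.indicator_of_notMem hm, Set.indicator_of_notMem (mt hiff.1 hm), sub_self, abs_zero]
        exact abs_nonneg _

/-- The backward step along one fixed sequence of paths: the strong laws appear as the hypotheses
`hcell`, `hthin` and `htail`, so no measurability of the estimated trees is needed. -/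
theorem tendsto_avg_policyPayoff_sub_sq [IsProbabilityMeasure P] (hX : ∀ j, Measurable (X j))
    (hh : ∀ j, Measurable (h j)) (hL2 : ∀ j, MemLp (fun ω => h j (X j ω)) 2 P)
    {T : Fin N → RegTree d p} {s : SplitStrategy d p} {j : Fin N} {l u : Fin d → ℝ}
    (hdens : P.map (X j.castSucc) ≪ volume)
    (hTuniq : ∀ t : RegTree d p, IsRegTree (theoreticalData P h T X j) l u s t →
      ∀ᵐ ω ∂P, t.eval (X j.castSucc ω) = (T j).eval (X j.castSucc ω))
    (hnd : P {ω | h j.castSucc (X j.castSucc ω) = (T j).eval (X j.castSucc ω)} = 0)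
    {x : ℕ → Fin (N + 1) → Fin d → ℝ}
    (hcell : ∀ c : List (Fin d × ℚ × Bool), ∀ r ≤ 2, Tendsto (fun M => avg M fun m =>
      (ratCell c).indicator (fun z => z.2 ^ r)
        (x m j.castSucc, policyPayoff h T (x m) j.succ)) atTop
      (𝓝 (∫ ω, (ratCell c).indicator (fun z => z.2 ^ r)
        (X j.castSucc ω, policyPayoff h T (fun k => X k ω) j.succ) ∂P)))
    (hthin : ∀ n : ℕ, Tendsto (fun M => avg M fun m =>
      {y : Fin d → ℝ | |h j.castSucc y - (T j).eval y| ≤ 1 / ((n : ℝ) + 1)}.indicator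
        (fun _ => 1) (x m j.castSucc)) atTop
      (𝓝 (∫ ω, {y : Fin d → ℝ | |h j.castSucc y - (T j).eval y| ≤ 1 / ((n : ℝ) + 1)}.indicator
        (fun _ => 1) (X j.castSucc ω) ∂P)))
    (htail : ∀ K : ℕ, Tendsto (fun M => avg M fun m =>
      {y : Fin (N + 1) → Fin d → ℝ | (K : ℝ) < ∑ k, h k (y k) ^ 2}.indicator
        (fun y => ∑ k, h k (y k) ^ 2) (x m)) atTop
      (𝓝 (∫ ω, {y : Fin (N + 1) → Fin d → ℝ | (K : ℝ) < ∑ k, h k (y k) ^ 2}.indicator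
        (fun y => ∑ k, h k (y k) ^ 2) (fun k => X k ω) ∂P)))
    {T' : ℕ → Fin N → RegTree d p}
    (hT' : ∀ M, IsRegTree (empiricalData h (T' M) M x j) l u s (T' M j))
    (hsucc : Tendsto (fun M => avg M fun m =>
      (policyPayoff h (T' M) (x m) j.succ - policyPayoff h T (x m) j.succ) ^ 2) atTop (𝓝 0)) :
    Tendsto (fun M => avg M fun m =>
      (policyPayoff h (T' M) (x m) j.castSucc - policyPayoff h T (x m) j.castSucc) ^ 2)
      atTop (𝓝 0) := by
  have hdata := measurable_data hX hh T j
  have hconv := momentConv_empiricalData hX hh hL2 hdens hcell hsucc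
  have htree : ∀ ε > 0, Tendsto (fun M => avg M fun m =>
      {y : Fin d → ℝ | ε < |(T' M j).eval y - (T j).eval y|}.indicator (fun _ => (1 : ℝ))
        (x m j.castSucc)) atTop (𝓝 0) := by
    intro ε hε
    have := hconv.tendsto_tree hT' (T := T j) (fun t' ht' => by
      have hm : MeasurableSet {y : Fin d → ℝ | t'.eval y ≠ (T j).eval y} :=
        (measurableSet_eq_fun t'.measurable_eval (T j).measurable_eval).compl
      rw [theoreticalData, Measure.map_apply hdata (show MeasurableSet
        {z : (Fin d → ℝ) × ℝ | t'.eval z.1 ≠ (T j).eval z.1} from measurable_fst hm)]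
      exact hTuniq t' ht') hε
    refine this.congr fun M => ?_
    rw [empiricalData, real_empMeasure _ _ (show MeasurableSet
      {z : (Fin d → ℝ) × ℝ | ε < |(T' M j).eval z.1 - (T j).eval z.1|} from
        measurableSet_lt measurable_const
          (((T' M j).measurable_eval.sub (T j).measurable_eval).comp measurable_fst).norm)]
    rfl
  -- the probability of being close to the exercise boundary is small
  have hthin0 : Tendsto (fun n : ℕ => ∫ ω,
      {y : Fin d → ℝ | |h j.castSucc y - (T j).eval y| ≤ 1 / ((n : ℝ) + 1)}.indicator
        (fun _ => (1 : ℝ)) (X j.castSucc ω) ∂P) atTop (𝓝 0) := by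
    rw [← integral_zero Ω ℝ (μ := P)]
    refine tendsto_integral_of_dominated_convergence (fun _ => 1) (fun n => ?_)
      (integrable_const 1) (fun n => Eventually.of_forall fun ω => ?_) ?_
    · exact ((measurable_const.indicator (measurableSet_le
        (((hh _).sub (T j).measurable_eval).norm) measurable_const)).comp
        (hX _)).aestronglyMeasurable
    · exact (norm_indicator_le_norm_self _ _).trans (by simp)
    · have hne : ∀ᵐ ω ∂P, h j.castSucc (X j.castSucc ω) ≠ (T j).eval (X j.castSucc ω) := by
        rw [ae_iff]
        simpa using hnd
      filter_upwards [hne] with ω hω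
      have hpos : 0 < |h j.castSucc (X j.castSucc ω) - (T j).eval (X j.castSucc ω)| :=
        abs_pos.2 (sub_ne_zero.2 hω)
      refine Tendsto.congr' (f₁ := fun _ => 0) ?_ tendsto_const_nhds
      filter_upwards [(tendsto_one_div_add_atTop_nhds_zero_nat (𝕜 := ℝ)).eventually
        (gt_mem_nhds hpos)] with n hn
      exact (Set.indicator_of_notMem
        (s := {y | |h j.castSucc y - (T j).eval y| ≤ 1 / ((n : ℝ) + 1)}) (not_le.2 hn) _).symm
  have htail0 : Tendsto (fun K : ℕ => ∫ ω,
      {y : Fin (N + 1) → Fin d → ℝ | (K : ℝ) < ∑ k, h k (y k) ^ 2}.indicator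
        (fun y => ∑ k, h k (y k) ^ 2) (fun k => X k ω) ∂P) atTop (𝓝 0) := by
    rw [← integral_zero Ω ℝ (μ := P)]
    have hG : Measurable fun y : Fin (N + 1) → Fin d → ℝ => ∑ k, h k (y k) ^ 2 :=
      Finset.measurable_fun_sum _ fun k _ => ((hh k).comp (measurable_pi_apply k)).pow_const 2
    refine tendsto_integral_of_dominated_convergence (fun ω => ∑ k, h k (X k ω) ^ 2)
      (fun K => ?_) (integrable_payoff_sq_sum hL2) (fun K => Eventually.of_forall fun ω => ?_)
      (Eventually.of_forall fun ω => ?_)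
    · exact ((hG.indicator (measurableSet_lt measurable_const hG)).comp
        (measurable_path hX)).aestronglyMeasurable
    · refine (norm_indicator_le_norm_self _ _).trans (le_of_eq ?_)
      exact abs_of_nonneg (Finset.sum_nonneg fun k _ => sq_nonneg _)
    · refine Tendsto.congr' (f₁ := fun _ => 0) ?_ tendsto_const_nhds
      filter_upwards [tendsto_natCast_atTop_atTop.eventually
        (eventually_ge_atTop (∑ k, h k (X k ω) ^ 2))] with K hK
      exact (Set.indicator_of_notMem (a := fun k => X k ω)
        (s := {y : Fin (N + 1) → Fin d → ℝ | (K : ℝ) < ∑ k, h k (y k) ^ 2}) (not_lt.2 hK) _).symm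
  rw [Metric.tendsto_nhds]
  intro ε hε
  -- The truncation level `K` comes first; `n` is then taken so large that `K` times the boundary
  -- probability is small. Two terms below `ε / 8`, times 4, stay below `ε`.
  obtain ⟨K, hK⟩ := (htail0.eventually (gt_mem_nhds (show 0 < ε / 8 by linarith))).exists
  have hthinK := hthin0.const_mul (K : ℝ)
  rw [mul_zero] at hthinK
  obtain ⟨n, hn⟩ := (hthinK.eventually (gt_mem_nhds (show 0 < ε / 8 by linarith))).exists
  have hlim := hsucc.add (((((htree _ (Nat.one_div_pos_of_nat (n := n))).const_mul (K : ℝ)).add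
    ((hthin n).const_mul (K : ℝ))).add (htail K)).const_mul 4)
  have hlt : 0 + 4 * ((K : ℝ) * 0 + K * (∫ ω,
      {y : Fin d → ℝ | |h j.castSucc y - (T j).eval y| ≤ 1 / ((n : ℝ) + 1)}.indicator
        (fun _ => (1 : ℝ)) (X j.castSucc ω) ∂P) + ∫ ω,
      {y : Fin (N + 1) → Fin d → ℝ | (K : ℝ) < ∑ k, h k (y k) ^ 2}.indicator
        (fun y => ∑ k, h k (y k) ^ 2) (fun k => X k ω) ∂P) < ε := by
    linarith
  filter_upwards [hlim.eventually (gt_mem_nhds hlt)] with M hM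
  rw [Real.dist_eq, sub_zero, abs_of_nonneg (avg_nonneg fun m => sq_nonneg _)]
  refine lt_of_le_of_lt ((avg_mono fun m =>
    policyPayoff_sub_sq_le h T (T' M) (x m) j (ε := 1 / ((n : ℝ) + 1)) K.cast_nonneg).trans
    (le_of_eq ?_)) hM
  rw [avg_add, avg_const_mul, avg_add, avg_add, avg_const_mul, avg_const_mul]

theorem integrable_policyPayoff_pow [IsFiniteMeasure P] (hX : ∀ j, Measurable (X j))
    (hh : ∀ j, Measurable (h j)) (hL2 : ∀ j, MemLp (fun ω => h j (X j ω)) 2 P)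
    (T : Fin N → RegTree d p) (j : Fin (N + 1)) (r : ℕ) (hr : r ≤ 2) :
    Integrable (fun ω => policyPayoff h T (fun k => X k ω) j ^ r) P := by
  have hY : Measurable fun ω => policyPayoff h T (fun k => X k ω) j :=
    (measurable_policyPayoff hh T j).comp (measurable_path hX)
  exact Integrable.mono' (g := fun ω => 1 + policyPayoff h T (fun k => X k ω) j ^ 2)
    ((integrable_const 1).add (integrable_policyPayoff_sq hX hh hL2 T j))
    (hY.pow_const r).aestronglyMeasurable
    (Eventually.of_forall fun ω => abs_pow_le_one_add_sq _ hr)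

/-- Strong laws of large numbers for the empirical policy, with moments up to order two. -/
theorem ae_tendsto_avg_policyPayoff [IsProbabilityMeasure P]
    (hX : ∀ j, Measurable (X j)) (hh : ∀ j, Measurable (h j))
    (hdens : ∀ j : Fin N, (j : ℕ) ≠ 0 → P.map (X j.castSucc) ≪ volume)
    (hL2 : ∀ j, MemLp (fun ω => h j (X j ω)) 2 P)
    {Xs : ℕ → Fin (N + 1) → Ω → Fin d → ℝ}
    (hindep : iIndepFun (fun (m : ℕ) (ω : Ω) (k : Fin (N + 1)) => Xs m k ω) P)
    (hident : ∀ m, IdentDistrib (fun (ω : Ω) (k : Fin (N + 1)) => Xs m k ω)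
      (fun (ω : Ω) (k : Fin (N + 1)) => X k ω) P P)
    {s : Fin N → SplitStrategy d p}
    {T : Fin N → RegTree d p}
    (hTuniq : ∀ j : Fin N, (j : ℕ) ≠ 0 → ∀ t : RegTree d p,
      IsRegTree (theoreticalData P h T X j) 0 1 (s j) t →
        ∀ᵐ ω ∂P, t.eval (X j.castSucc ω) = (T j).eval (X j.castSucc ω))
    {That : ℕ → Ω → Fin N → RegTree d p}
    (hThat : ∀ (M : ℕ) (ω : Ω) (j : Fin N), (j : ℕ) ≠ 0 →
      IsRegTree (empiricalData h (That M ω) M (fun m k => Xs m k ω) j) 0 1 (s j) (That M ω j))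
    (hnd : ∀ j : Fin N, (j : ℕ) ≠ 0 →
      P {ω | h j.castSucc (X j.castSucc ω) = (T j).eval (X j.castSucc ω)} = 0) :
    ∀ᵐ ω ∂P, ∀ j : Fin (N + 1), j ≠ 0 → ∀ r ≤ 2, Tendsto
      (fun M => avg M fun m => policyPayoff h (That M ω) (fun k => Xs m k ω) j ^ r) atTop
      (𝓝 (∫ ω, policyPayoff h T (fun k => X k ω) j ^ r ∂P)) := by
  have hG : Measurable fun y : Fin (N + 1) → Fin d → ℝ => ∑ k, h k (y k) ^ 2 :=
    Finset.measurable_fun_sum _ fun k _ => ((hh k).comp (measurable_pi_apply k)).pow_const 2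
  -- Rational thresholds make the family of cells countable, so a single null set suffices.
  have hcell : ∀ᵐ ω ∂P, ∀ (j : Fin N) (c : List (Fin d × ℚ × Bool)) (r : ℕ), r ≤ 2 →
      Tendsto (fun M => avg M fun m => (ratCell c).indicator (fun z => z.2 ^ r)
        (Xs m j.castSucc ω, policyPayoff h T (fun k => Xs m k ω) j.succ)) atTop
      (𝓝 (∫ ω, (ratCell c).indicator (fun z => z.2 ^ r)
        (X j.castSucc ω, policyPayoff h T (fun k => X k ω) j.succ) ∂P)) := by
    simp only [ae_all_iff]
    intro j c r hr
    refine ae_tendsto_avg_comp (F := fun y => (ratCell c).indicator (fun z => z.2 ^ r)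
      (y j.castSucc, policyPayoff h T y j.succ)) hindep hident ?_ ?_
    · exact (Measurable.indicator (by fun_prop) (measurableSet_ratCell c)).comp
        ((measurable_pi_apply _).prodMk (measurable_policyPayoff hh T _))
    · refine (integrable_policyPayoff_pow hX hh hL2 T j.succ r hr).mono ?_ (Eventually.of_forall fun ω =>
        norm_indicator_le_norm_self _ _)
      exact ((Measurable.indicator (by fun_prop) (measurableSet_ratCell c)).comp
        (measurable_data hX hh T j)).aestronglyMeasurable
  have hthin : ∀ᵐ ω ∂P, ∀ (j : Fin N) (n : ℕ), Tendsto (fun M => avg M fun m =>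
      {y : Fin d → ℝ | |h j.castSucc y - (T j).eval y| ≤ 1 / ((n : ℝ) + 1)}.indicator
        (fun _ => 1) (Xs m j.castSucc ω)) atTop
      (𝓝 (∫ ω, {y : Fin d → ℝ | |h j.castSucc y - (T j).eval y| ≤ 1 / ((n : ℝ) + 1)}.indicator
        (fun _ => 1) (X j.castSucc ω) ∂P)) := by
    simp only [ae_all_iff]
    intro j n
    have hm : Measurable
        ({y : Fin d → ℝ | |h j.castSucc y - (T j).eval y| ≤ 1 / ((n : ℝ) + 1)}.indicator
          fun _ => (1 : ℝ)) :=
      measurable_const.indicator (measurableSet_le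
        (((hh _).sub (T j).measurable_eval).norm) measurable_const)
    refine ae_tendsto_avg_comp (F := fun y => {y : Fin d → ℝ |
      |h j.castSucc y - (T j).eval y| ≤ 1 / ((n : ℝ) + 1)}.indicator (fun _ => 1)
        (y j.castSucc)) hindep hident (hm.comp (measurable_pi_apply _)) ?_
    exact (integrable_const (1 : ℝ)).mono (hm.comp (hX _)).aestronglyMeasurable
      (Eventually.of_forall fun ω => norm_indicator_le_norm_self _ _)
  have htail : ∀ᵐ ω ∂P, ∀ K : ℕ, Tendsto (fun M => avg M fun m =>
      {y : Fin (N + 1) → Fin d → ℝ | (K : ℝ) < ∑ k, h k (y k) ^ 2}.indicator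
        (fun y => ∑ k, h k (y k) ^ 2) (fun k => Xs m k ω)) atTop
      (𝓝 (∫ ω, {y : Fin (N + 1) → Fin d → ℝ | (K : ℝ) < ∑ k, h k (y k) ^ 2}.indicator
        (fun y => ∑ k, h k (y k) ^ 2) (fun k => X k ω) ∂P)) := by
    simp only [ae_all_iff]
    intro K
    have hm := hG.indicator (measurableSet_lt (measurable_const (a := (K : ℝ))) hG)
    refine ae_tendsto_avg_comp hindep hident hm ?_
    exact (integrable_payoff_sq_sum hL2).mono (hm.comp (measurable_path hX)).aestronglyMeasurable
      (Eventually.of_forall fun ω => norm_indicator_le_norm_self _ _)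
  have hmom : ∀ᵐ ω ∂P, ∀ (j : Fin (N + 1)) (r : ℕ), r ≤ 2 → Tendsto
      (fun M => avg M fun m => policyPayoff h T (fun k => Xs m k ω) j ^ r) atTop
      (𝓝 (∫ ω, policyPayoff h T (fun k => X k ω) j ^ r ∂P)) := by
    simp only [ae_all_iff]
    intro j r hr
    exact ae_tendsto_avg_comp (F := fun y => policyPayoff h T y j ^ r) hindep hident
      ((measurable_policyPayoff hh T j).pow_const r) (integrable_policyPayoff_pow hX hh hL2 T j r hr)
  filter_upwards [hcell, hthin, htail, hmom] with ω h1 h2 h3 h4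
  have hdist : ∀ j : Fin (N + 1), j ≠ 0 → Tendsto (fun M => avg M fun m =>
      (policyPayoff h (That M ω) (fun k => Xs m k ω) j
        - policyPayoff h T (fun k => Xs m k ω) j) ^ 2) atTop (𝓝 0) := by
    intro j
    induction j using Fin.reverseInduction with
    | last =>
      intro _
      -- At the last date there is no decision, and both policies pay the same.
      simp [policyPayoff_last, avg]
    | cast j ih =>
      intro hj
      have hj' : (j : ℕ) ≠ 0 := fun h0 => hj (Fin.ext h0)
      exact tendsto_avg_policyPayoff_sub_sq hX hh hL2 (T := T)
        (x := fun m k => Xs m k ω) (hdens j hj') (hTuniq j hj') (hnd j hj')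
        (h1 j) (h2 j) h3
        (T' := fun M => That M ω) (fun M => hThat M ω j hj') (ih (Fin.succ_ne_zero j))
  intro j hj r hr
  have hdiff := tendsto_avg_abs_pow_sub (hdist j hj) (h4 j 2 le_rfl) hr
  have hzero := squeeze_zero_norm (f := fun M =>
    (avg M fun m => policyPayoff h (That M ω) (fun k => Xs m k ω) j ^ r)
      - avg M fun m => policyPayoff h T (fun k => Xs m k ω) j ^ r) (fun M => by
    rw [← avg_sub]
    exact abs_avg_le _ _) hdiff
  simpa using hzero.add (h4 j r hr)

end Consistency

theorem theorem4p8 {Ω : Type*} [MeasurableSpace Ω] (P : Measure Ω) [IsProbabilityMeasure P]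
    (d N p : ℕ) (hN : 1 ≤ N)
    -- the process at the dates of indices `0, …, N` and the discounted payoff functions
    (X : Fin (N + 1) → Ω → Fin d → ℝ) (h : Fin (N + 1) → (Fin d → ℝ) → ℝ)
    (hX : ∀ j, Measurable (X j)) (hh : ∀ j, Measurable (h j))
    -- at the dates of indices `1, …, N - 1`, values in the unit cube, with a density
    (hcube : ∀ j : Fin N, (j : ℕ) ≠ 0 → ∀ᵐ ω ∂P, X j.castSucc ω ∈ Set.Icc 0 1)
    (hdens : ∀ j : Fin N, (j : ℕ) ≠ 0 → P.map (X j.castSucc) ≪ volume)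
    (hL2 : ∀ j, MemLp (fun ω => h j (X j ω)) 2 P)
    -- the Monte Carlo paths: independent copies of the process
    (Xs : ℕ → Fin (N + 1) → Ω → Fin d → ℝ)
    (hindep : iIndepFun (fun (m : ℕ) (ω : Ω) (k : Fin (N + 1)) => Xs m k ω) P)
    (hident : ∀ m, IdentDistrib (fun (ω : Ω) (k : Fin (N + 1)) => Xs m k ω)
      (fun (ω : Ω) (k : Fin (N + 1)) => X k ω) P P)
    -- the splitting strategies, common to the theoretical and to the empirical trees
    (s : Fin N → SplitStrategy d p)
    -- the theoretical trees, which are well defined: optimal splits determine them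
    (T : Fin N → RegTree d p)
    (hT : ∀ j : Fin N, (j : ℕ) ≠ 0 → IsRegTree (theoreticalData P h T X j) 0 1 (s j) (T j))
    (hTuniq : ∀ j : Fin N, (j : ℕ) ≠ 0 → ∀ t : RegTree d p,
      IsRegTree (theoreticalData P h T X j) 0 1 (s j) t →
        ∀ᵐ ω ∂P, t.eval (X j.castSucc ω) = (T j).eval (X j.castSucc ω))
    -- the empirical trees, computed from the first `M` paths
    (That : ℕ → Ω → Fin N → RegTree d p)
    (hThat : ∀ (M : ℕ) (ω : Ω) (j : Fin N), (j : ℕ) ≠ 0 →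
      IsRegTree (empiricalData h (That M ω) M (fun m k => Xs m k ω) j) 0 1 (s j) (That M ω j))
    -- non-degeneracy
    (hnd : ∀ j : Fin N, (j : ℕ) ≠ 0 →
      P {ω | h j.castSucc (X j.castSucc ω) = (T j).eval (X j.castSucc ω)} = 0) :
    (∀ α ∈ ({1, 2} : Set ℕ), ∀ j : Fin (N + 1), j ≠ 0 →
      Integrable (fun ω => policyPayoff h T (fun k => X k ω) j ^ α) P ∧
      ∀ᵐ ω ∂P, Tendsto
        (fun M : ℕ => (M : ℝ)⁻¹ * ∑ m ∈ Finset.range M,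
          policyPayoff h (That M ω) (fun k => Xs m k ω) j ^ α)
        atTop (𝓝 (∫ ω', policyPayoff h T (fun k => X k ω') j ^ α ∂P))) ∧
    -- the price estimator
    (∀ᵐ ω ∂P, Tendsto
      (fun M : ℕ => max (h 0 (X 0 ω)) ((M : ℝ)⁻¹ * ∑ m ∈ Finset.range M,
        policyPayoff h (That M ω) (fun k => Xs m k ω) ⟨1, by omega⟩))
      atTop (𝓝 (max (h 0 (X 0 ω))
        (∫ ω', policyPayoff h T (fun k => X k ω') ⟨1, by omega⟩ ∂P)))) := by
  have hmain := ae_tendsto_avg_policyPayoff hX hh hdens hL2 hindep hident hTuniq hThat hnd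
  have hα : ∀ α ∈ ({1, 2} : Set ℕ), α ≤ 2 := by
    rintro α (rfl | rfl) <;> norm_num
  refine ⟨fun α hα' j hj => ⟨integrable_policyPayoff_pow hX hh hL2 T j α (hα α hα'), ?_⟩, ?_⟩
  · filter_upwards [hmain] with ω hω
    exact hω j hj α (hα α hα')
  · filter_upwards [hmain] with ω hω
    have h1 := hω ⟨1, by omega⟩ (by simp [Fin.ext_iff]) 1 (by norm_num)
    simp only [pow_one] at h1
    exact tendsto_const_nhds.max h1
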